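/- Let $j_A\in\{\tfrac12,1,\tfrac32,\dots\}$ and $j_B\in\{0,\tfrac12,1,\dots\}$, and let $\mathcal H_A$, $\mathcal H_B$ be the Hilbert spaces of a spin-$j_A$ and a spin-$j_B$ system, of dimensions $2j_A+1$ and $2j_B+1$, with spin operators $\mathbf J_A=(J_A^x,J_A^y,J_A^z)$, $\mathbf J_B=(J_B^x,J_B^y,J_B^z)$ and $\mathrm{SU}(2)$ acting by $U_A(\mathbf g)=e^{i\mathbf J_A\cdot\mathbf g}$, $U_B(\mathbf g)=e^{i\mathbf J_B\cdot\mathbf g}$. For an operator $\rho$ on either space let $\mathbf P(\rho)=\operatorname{tr}(\mathbf J\rho)$ be its polarisation vector. A channel $\mathcal E:\mathcal B(\mathcal H_A)\to\mathcal B(\mathcal H_B)$ is a completely positive trace-preserving linear map; it is $\mathrm{SU}(2)$-covariant if $U_B(\mathbf g)^\dagger\,\mathcal E\big(U_A(\mathbf g)XU_A(\mathbf g)^\dagger\big)U_B(\mathbf g)=\mathcal E(X)$ for all $\mathbf g$ and $X$; it scales the polarisation by $\kappa\in\mathbb R$ if $\mathbf P(\mathcal E(\rho))=\kappa\,\mathbf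 P(\rho)$ for all states $\rho$. For $L\in\{|j_A-j_B|,\dots,j_A+j_B\}$ let $\mathcal E^{(L)}$ be the linear map whose Jamiołkowski state $(\mathcal E^{(L)}\otimes\mathrm{id})(|\Omega\rangle\langle\Omega|)$, with $|\Omega\rangle=(2j_A+1)^{-1/2}\sum_i|ii\rangle$, is $\mathbb 1^L/(2L+1)$, where $\mathbb 1^L$ is the orthogonal projector onto the spin-$L$ irreducible subspace of $\mathcal H_B\otimes\mathcal H_A$ under $U_B\otimes U_A^*$. Then every $\mathrm{SU}(2)$-covariant channel scales the polarisation by a unique factor $\kappa$. The map $\mathcal E^{(j_A+j_B)}$ is an extreme point of the convex set of $\mathrm{SU}(2)$-covariant channels, and it scales the polarisation by $$\kappa_-=-\frac{j_B}{j_A+1}.$$ This is the least factor attained by any $\mathrm{SU}(2)$-covariant channel, and also the least factor attained by any channel that scales the polarisation. Moreover $\kappa_-<0$ if $j_B>0$, and for $j_A=j_B=j$ one has $\kappa_-=-j/(j+1)$. -/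

import Mathlib

noncomputable section

namespace SpinChannel

open scoped ComplexOrder

/-- A spin-`j` system is encoded by the natural number `n = 2j`; its spin is `j = n / 2`. -/
def spin (n : ℕ) : ℝ := (n : ℝ) / 2

/-- Operators on the Hilbert space `ℂ^(2j+1)` of a spin-`j` system, `n = 2j`. The basis vector with
index `i : Fin (n + 1)` is `|j, m⟩` with `m = j - i`. -/
abbrev Op (n : ℕ) : Type := Matrix (Fin (n + 1)) (Fin (n + 1)) ℂ

/-- Linear superoperators from a spin-`a/2` system to a spin-`b/2` system. -/
abbrev SuperOp (a b : ℕ) : Type := Op a →ₗ[ℂ] Op b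

/-! ### Spin operators, rotations, polarisation -/

/-- The raising operator, `J₊ |j, m⟩ = √(j(j+1) - m(m+1)) |j, m + 1⟩`.
For `m = j - k` the radicand is `k (2j + 1 - k)`. -/
def raising (n : ℕ) : Op n :=
  Matrix.of fun i k =>
    if (i : ℕ) + 1 = (k : ℕ) then ((Real.sqrt ((k : ℝ) * ((n : ℝ) + 1 - (k : ℝ))) : ℝ) : ℂ) else 0

/-- The lowering operator `J₋ = J₊†`. -/
def lowering (n : ℕ) : Op n := (raising n).conjTranspose

/-- The spin operators `(J^x, J^y, J^z)`, indexed by `0, 1, 2`. -/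
def spinOp (n : ℕ) : Fin 3 → Op n :=
  ![(1 / 2 : ℂ) • (raising n + lowering n),
    (1 / (2 * Complex.I) : ℂ) • (raising n - lowering n),
    Matrix.diagonal fun i => ((spin n - (i : ℝ) : ℝ) : ℂ)]

/-- The unitary `U(g) = exp(i J · g)`. As `g` runs over `ℝ³`, these are exactly the operators
that represent the elements of `SU(2)` in its spin-`n/2` irreducible representation. -/
def rotation (n : ℕ) (g : Fin 3 → ℝ) : Op n :=
  NormedSpace.exp (Complex.I • ∑ k, (g k : ℂ) • spinOp n k)

/-- Density operators. -/
def IsState {n : ℕ} (ρ : Op n) : Prop := ρ.PosSemidef ∧ ρ.trace = 1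

/-- The spin polarisation vector `P_k(ρ) = tr(J^k ρ)`. -/
def polarisation {n : ℕ} (ρ : Op n) (k : Fin 3) : ℂ := (spinOp n k * ρ).trace

/-- `P(E(ρ)) = κ P(ρ)` for all states `ρ`. -/
def ScalesPolarisation {a b : ℕ} (E : SuperOp a b) (κ : ℝ) : Prop :=
  ∀ ρ : Op a, IsState ρ → ∀ k, polarisation (E ρ) k = (κ : ℂ) * polarisation ρ k

/-! ### Channels -/

/-- `E ⊗ id_R`, acting on operators on `ℋ_A ⊗ ℂ^R`. -/
def ampliation {a b : ℕ} (R : Type) (E : SuperOp a b)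
    (X : Matrix (Fin (a + 1) × R) (Fin (a + 1) × R) ℂ) :
    Matrix (Fin (b + 1) × R) (Fin (b + 1) × R) ℂ :=
  Matrix.of fun p q => E (Matrix.of fun i j => X (i, p.2) (j, q.2)) p.1 q.1

/-- Complete positivity: `E ⊗ id_r` is positive for every `r`. -/
def IsCompletelyPositive {a b : ℕ} (E : SuperOp a b) : Prop :=
  ∀ (r : ℕ) (X : Matrix (Fin (a + 1) × Fin r) (Fin (a + 1) × Fin r) ℂ),
    X.PosSemidef → (ampliation (Fin r) E X).PosSemidef

/-- Quantum channels: completely positive trace-preserving maps. -/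
def IsChannel {a b : ℕ} (E : SuperOp a b) : Prop :=
  IsCompletelyPositive E ∧ ∀ X : Op a, (E X).trace = X.trace

/-- Covariance under `SU(2)`: `U_B(g)† E(U_A(g) X U_A(g)†) U_B(g) = E(X)`. -/
def IsCovariant {a b : ℕ} (E : SuperOp a b) : Prop :=
  ∀ (g : Fin 3 → ℝ) (X : Op a),
    (rotation b g).conjTranspose * E (rotation a g * X * (rotation a g).conjTranspose) *
      rotation b g = E X

/-- The convex set of `SU(2)`-covariant channels from spin `a/2` to spin `b/2`. -/
def covariantChannels (a b : ℕ) : Set (SuperOp a b) :=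
  {E | IsChannel E ∧ IsCovariant E}

/-! ### Jamiołkowski states and the channels `E^L` -/

/-- The maximally entangled vector `|Ω⟩ = (1/√d_A) ∑ |i i⟩`, `d_A = a + 1`. -/
def maxEntangled (a : ℕ) : Fin (a + 1) × Fin (a + 1) → ℂ :=
  fun p => if p.1 = p.2 then ((1 / Real.sqrt ((a : ℝ) + 1) : ℝ) : ℂ) else 0

/-- The Jamiołkowski state `(E ⊗ id_A)(|Ω⟩⟨Ω|)` on `ℋ_B ⊗ ℋ_A`. -/
def jamiolkowski {a b : ℕ} (E : SuperOp a b) :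
    Matrix (Fin (b + 1) × Fin (a + 1)) (Fin (b + 1) × Fin (a + 1)) ℂ :=
  ampliation (Fin (a + 1)) E (Matrix.vecMulVec (maxEntangled a) (star (maxEntangled a)))

/-- The generators `J_B^k ⊗ 1 - 1 ⊗ (J_A^k)^*` of the representation `U_B(g) ⊗ U_A(g)^*`
on `ℋ_B ⊗ ℋ_A`; the star is entrywise complex conjugation. -/
def totalSpinOp (a b : ℕ) (k : Fin 3) :
    Matrix (Fin (b + 1) × Fin (a + 1)) (Fin (b + 1) × Fin (a + 1)) ℂ :=
  Matrix.kronecker (spinOp b k) (1 : Op a) - Matrix.kronecker (1 : Op b) ((spinOp a k).map star)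

/-- The subspace of `ℋ_B ⊗ ℋ_A` of total angular momentum `L = c / 2` for the representation
`U_B ⊗ U_A^*`: the eigenspace of the total squared angular momentum for `L (L + 1)`. Since
`U_B ⊗ U_A^*` is multiplicity-free, it is the irreducible subspace of spin `L` when `L` is one of
`|j_A - j_B|, …, j_A + j_B`. -/
def irrepSubspace (a b c : ℕ) : Submodule ℂ (EuclideanSpace ℂ (Fin (b + 1) × Fin (a + 1))) :=
  Module.End.eigenspace
    (Matrix.toEuclideanLin (∑ k, totalSpinOp a b k * totalSpinOp a b k))
    ((spin c * (spin c + 1) : ℝ) : ℂ)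

/-- The matrix of the orthogonal projector onto the spin-`c/2` subspace of `ℋ_B ⊗ ℋ_A`. -/
def irrepProjector (a b c : ℕ) :
    Matrix (Fin (b + 1) × Fin (a + 1)) (Fin (b + 1) × Fin (a + 1)) ℂ :=
  Matrix.toEuclideanLin.symm ((irrepSubspace a b c).starProjection :
    EuclideanSpace ℂ (Fin (b + 1) × Fin (a + 1)) →ₗ[ℂ]
      EuclideanSpace ℂ (Fin (b + 1) × Fin (a + 1)))

/-- `E` is the map `E^L`, `L = c / 2`: its Jamiołkowski state is the normalised projector
`1^L / (2L + 1)`. Since a superoperator is determined by its Jamiołkowski state, there is exactly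
one such `E`. -/
def IsIrrepChannel {a b : ℕ} (c : ℕ) (E : SuperOp a b) : Prop :=
  jamiolkowski E = ((1 / (2 * spin c + 1) : ℝ) : ℂ) • irrepProjector a b c

end SpinChannel

end

/-! Identify a map with its Choi matrix `C` on `ℋ_B ⊗ ℋ_A`, let `T` be the total spin of `U_B ⊗
U_A^*`, and put `L = j_A + j_B`. Expanding `T²` shows that the gap `G = L(L+1) - T²` equals `2(∑
J_B^k ⊗ (J_A^k)^* + j_A j_B)`. For a trace-preserving map with factor `κ` this gives `tr(C G) =
2(2j_A+1) j_A (κ(j_A+1) + j_B)` (`trace_choi_mul_casimirGap`). For a channel, `C` and `G` are both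
positive, so `κ ≥ -j_B/(j_A+1)`; covariance plays no role here. Equality forces `G C = 0`, so `C`
lives on the spin-`L` subspace. If the channel is also covariant, `C` commutes with `T`, and Schur's
lemma (`eq_smul_irrepProjector`) together with the trace leaves only `E^(L)`. The unique minimiser
of an affine functional on a convex set is an extreme point.

Positivity of `G` and Schur's lemma need no Clebsch–Gordan decomposition. If `M` commutes with `T₋`
and `T² M = μ M`, then the traces of `M` on neighbouring weight spaces agree unless the ladder
coefficient vanishes (`trace_depthProjector_step`). For `μ > L(L+1)` the chain starts at an empty
weight space, so the trace of `M` is zero. For `μ = L(L+1)` it starts at the one-dimensional top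
weight space, so the trace is `2L+1` times the top entry.

A covariant map scales the polarisation because its trace dual intertwines the adjoint actions: the
image of `J₊` has the commutators of `J₊` with `J^z` and `J₊`, hence is a multiple of `J₊`, and
commuting with `J₋` yields the other components. Covariance enters through its derivative, which
says that `C` commutes with `T`. -/

noncomputable section

namespace SpinChannel

open scoped ComplexOrder
open Complex (I)
open Matrix

/-! ### Spin triples -/

/-- Elements of a complex algebra that satisfy the commutation relations of the spin operators. -/
structure IsSpinTriple {R : Type*} [Ring R] [Algebra ℂ R] (J : Fin 3 → R) : Prop where
  xy : J 0 * J 1 - J 1 * J 0 = I • J 2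
  yz : J 1 * J 2 - J 2 * J 1 = I • J 0
  zx : J 2 * J 0 - J 0 * J 2 = I • J 1

/-- The raising element `J^x + i J^y`. -/
def up {R : Type*} [Ring R] [Algebra ℂ R] (J : Fin 3 → R) : R := J 0 + I • J 1

/-- The lowering element `J^x - i J^y`. -/
def down {R : Type*} [Ring R] [Algebra ℂ R] (J : Fin 3 → R) : R := J 0 - I • J 1

/-- The total squared angular momentum. -/
def casimir {R : Type*} [Ring R] (J : Fin 3 → R) : R := ∑ k, J k * J k

namespace IsSpinTriple

variable {R : Type*} [Ring R] [Algebra ℂ R] {J : Fin 3 → R}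

theorem down_mul_up (h : IsSpinTriple J) :
    down J * up J = casimir J - J 2 * J 2 - J 2 := by
  have e : down J * up J = J 0 * J 0 + J 1 * J 1 + I • (J 0 * J 1 - J 1 * J 0) := by
    simp only [down, up, sub_mul, mul_add, smul_mul_assoc, mul_smul_comm, smul_smul,
      Complex.I_mul_I, smul_sub, neg_smul, one_smul]
    abel
  rw [e, h.xy, smul_smul, Complex.I_mul_I, neg_smul, one_smul, casimir, Fin.sum_univ_three]
  abel

theorem up_mul_down (h : IsSpinTriple J) :
    up J * down J = casimir J - J 2 * J 2 + J 2 := by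
  have e : up J * down J = J 0 * J 0 + J 1 * J 1 - I • (J 0 * J 1 - J 1 * J 0) := by
    simp only [down, up, mul_sub, add_mul, smul_mul_assoc, mul_smul_comm, smul_add, smul_smul,
      Complex.I_mul_I, smul_sub, neg_smul, one_smul]
    abel
  rw [e, h.xy, smul_smul, Complex.I_mul_I, neg_smul, one_smul, casimir, Fin.sum_univ_three]
  abel

/-- By the Leibniz rule `[x, y²] = [x, y] y + y [x, y]`, the contributions of the two other
components cancel. -/
theorem commute_casimir (h : IsSpinTriple J) (k : Fin 3) : Commute (J k) (casimir J) := by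
  have key : ∀ x y : R, x * (y * y) - y * y * x = (x * y - y * x) * y + y * (x * y - y * x) := by
    intro x y; noncomm_ring
  have hyx : J 1 * J 0 - J 0 * J 1 = -(I • J 2) := by rw [← h.xy]; abel
  have hzy : J 2 * J 1 - J 1 * J 2 = -(I • J 0) := by rw [← h.yz]; abel
  have hxz : J 0 * J 2 - J 2 * J 0 = -(I • J 1) := by rw [← h.zx]; abel
  rw [commute_iff_eq, ← sub_eq_zero, casimir, Fin.sum_univ_three]
  have e : ∀ x : R, x * (J 0 * J 0 + J 1 * J 1 + J 2 * J 2) - (J 0 * J 0 + J 1 * J 1 + J 2 * J 2) * x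
      = (x * (J 0 * J 0) - J 0 * J 0 * x) + (x * (J 1 * J 1) - J 1 * J 1 * x)
        + (x * (J 2 * J 2) - J 2 * J 2 * x) := by
    intro x; noncomm_ring
  rw [e, key, key, key]
  fin_cases k
  · simp only [Fin.zero_eta, h.xy, hxz, sub_self, neg_mul, mul_neg, smul_mul_assoc, mul_smul_comm]
    abel_nf; simp
  · simp only [Fin.mk_one, hyx, h.yz, sub_self, neg_mul, mul_neg, smul_mul_assoc, mul_smul_comm]
    abel_nf; simp
  · simp only [Fin.reduceFinMk, hzy, h.zx, sub_self, neg_mul, mul_neg, smul_mul_assoc, mul_smul_comm]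
    abel_nf; simp

end IsSpinTriple

/-! ### The spin operators -/

theorem spinOp_two (n : ℕ) :
    spinOp n 2 = Matrix.diagonal fun i : Fin (n + 1) => ((spin n - (i : ℝ) : ℝ) : ℂ) := rfl

theorem up_spinOp (n : ℕ) : up (spinOp n) = raising n := by
  have h0 : spinOp n 0 = (1 / 2 : ℂ) • (raising n + lowering n) := rfl
  have h1 : spinOp n 1 = (1 / (2 * I) : ℂ) • (raising n - lowering n) := rfl
  rw [up, h0, h1, smul_smul, show I * (1 / (2 * I)) = 1 / 2 by field_simp [Complex.I_ne_zero]]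
  rw [← smul_add, add_add_sub_cancel, ← two_smul ℂ, smul_smul]
  norm_num

theorem down_spinOp (n : ℕ) : down (spinOp n) = lowering n := by
  have h0 : spinOp n 0 = (1 / 2 : ℂ) • (raising n + lowering n) := rfl
  have h1 : spinOp n 1 = (1 / (2 * I) : ℂ) • (raising n - lowering n) := rfl
  rw [down, h0, h1, smul_smul, show I * (1 / (2 * I)) = 1 / 2 by field_simp [Complex.I_ne_zero]]
  rw [← smul_sub, add_sub_sub_cancel, ← two_smul ℂ, smul_smul]
  norm_num

theorem lowering_apply (n : ℕ) (i k : Fin (n + 1)) : lowering n i k =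
    if (k : ℕ) + 1 = (i : ℕ) then ((Real.sqrt ((i : ℝ) * ((n : ℝ) + 1 - (i : ℝ))) : ℝ) : ℂ) else 0 := by
  simp only [lowering, conjTranspose_apply, raising, of_apply]
  split_ifs <;> simp

theorem sqrt_mul_sqrt_ladder (n k : ℕ) (hk : k ≤ n + 1) :
    ((Real.sqrt ((k : ℝ) * ((n : ℝ) + 1 - (k : ℝ))) : ℝ) : ℂ) *
      ((Real.sqrt ((k : ℝ) * ((n : ℝ) + 1 - (k : ℝ))) : ℝ) : ℂ) = k * (n + 1 - k) := by
  have : (k : ℝ) ≤ n + 1 := by exact_mod_cast hk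
  rw [← Complex.ofReal_mul, Real.mul_self_sqrt (mul_nonneg (by positivity) (by linarith))]
  push_cast; ring

theorem raising_mul_lowering (n : ℕ) : raising n * lowering n =
    Matrix.diagonal fun i : Fin (n + 1) => ((i : ℂ) + 1) * (n - i) := by
  ext i k
  rw [Matrix.mul_apply, diagonal_apply]
  simp only [lowering_apply, raising, of_apply]
  by_cases hi : (i : ℕ) + 1 < n + 1
  · rw [Finset.sum_eq_single ⟨i + 1, hi⟩]
    · simp only [↓reduceIte]
      by_cases hik : i = k
      · subst hik
        simp only [↓reduceIte, sqrt_mul_sqrt_ladder n (i + 1) hi.le]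
        push_cast; ring
      · rw [if_neg hik, if_neg (fun h => hik (Fin.ext (by omega))), mul_zero]
    · intro l _ hl
      rw [if_neg (fun h => hl (Fin.ext h.symm)), zero_mul]
    · simp
  · have hin : (i : ℕ) = n := by omega
    rw [Finset.sum_eq_zero]
    · simp [hin]
    · intro l _
      rw [if_neg (by omega), zero_mul]

theorem lowering_mul_raising (n : ℕ) : lowering n * raising n =
    Matrix.diagonal fun i : Fin (n + 1) => (i : ℂ) * (n + 1 - i) := by
  ext i k
  rw [Matrix.mul_apply, diagonal_apply]
  simp only [lowering_apply, raising, of_apply]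
  by_cases hi : 0 < (i : ℕ)
  · have hi' : (i : ℕ) - 1 + 1 = i := by omega
    rw [Finset.sum_eq_single ⟨i - 1, by omega⟩]
    · simp only [hi', ↓reduceIte]
      by_cases hik : i = k
      · subst hik
        simp only [↓reduceIte, sqrt_mul_sqrt_ladder n i (by omega)]
      · rw [if_neg hik, if_neg (fun h => hik (Fin.ext (by omega))), mul_zero]
    · intro l _ hl
      rw [if_neg (fun h => hl (Fin.ext (by simp; omega))), zero_mul]
    · simp
  · have hin : (i : ℕ) = 0 := by omega
    rw [Finset.sum_eq_zero]
    · simp [hin]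
    · intro l _
      rw [if_neg (by omega), zero_mul]

theorem spinOp_two_comm_raising (n : ℕ) :
    spinOp n 2 * raising n - raising n * spinOp n 2 = raising n := by
  ext i k
  rw [spinOp_two, Matrix.sub_apply, diagonal_mul, mul_diagonal]
  simp only [raising, of_apply]
  split_ifs with h
  · have : (k : ℂ) = i + 1 := by exact_mod_cast h.symm
    push_cast
    rw [this]; ring
  · ring

theorem spinOp_two_comm_lowering (n : ℕ) :
    spinOp n 2 * lowering n - lowering n * spinOp n 2 = -lowering n := by
  ext i k
  rw [spinOp_two, Matrix.sub_apply, diagonal_mul, mul_diagonal, Matrix.neg_apply]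
  simp only [lowering_apply]
  split_ifs with h
  · have : (i : ℂ) = k + 1 := by exact_mod_cast h.symm
    push_cast
    rw [this]; ring
  · ring

theorem raising_comm_lowering (n : ℕ) :
    raising n * lowering n - lowering n * raising n = (2 : ℂ) • spinOp n 2 := by
  rw [raising_mul_lowering, lowering_mul_raising, spinOp_two, diagonal_sub, ← diagonal_smul]
  congr 1
  ext i
  simp only [Pi.smul_apply, smul_eq_mul, spin]
  push_cast; ring

theorem isSpinTriple_spinOp (n : ℕ) : IsSpinTriple (spinOp n) := by
  have h0 : spinOp n 0 = (1 / 2 : ℂ) • (raising n + lowering n) := rfl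
  have h1 : spinOp n 1 = (1 / (2 * I) : ℂ) • (raising n - lowering n) := rfl
  have hz := spinOp_two_comm_raising n
  have hz' := spinOp_two_comm_lowering n
  have hr := raising_comm_lowering n
  have hI : (1 / (2 * I) : ℂ) = -(1 / 2) * I := by
    field_simp [Complex.I_ne_zero]; simp
  have hII : I * I = -1 := Complex.I_mul_I
  refine ⟨?_, ?_, ?_⟩
  · have e : spinOp n 0 * spinOp n 1 - spinOp n 1 * spinOp n 0 =
        (I / 2) • (raising n * lowering n - lowering n * raising n) := by
      rw [h0, h1, hI]
      simp only [smul_mul_smul_comm, add_mul, mul_add, sub_mul, mul_sub]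
      module
    rw [e, hr, smul_smul]; congr 1; ring
  · have e : spinOp n 1 * spinOp n 2 - spinOp n 2 * spinOp n 1 =
        (I / 2) • ((spinOp n 2 * raising n - raising n * spinOp n 2) -
          (spinOp n 2 * lowering n - lowering n * spinOp n 2)) := by
      rw [h1, hI]
      simp only [smul_mul_assoc, mul_smul_comm, sub_mul, mul_sub]
      module
    rw [e, hz, hz', h0]
    module
  · have e : spinOp n 2 * spinOp n 0 - spinOp n 0 * spinOp n 2 =
        (1 / 2 : ℂ) • ((spinOp n 2 * raising n - raising n * spinOp n 2) +
          (spinOp n 2 * lowering n - lowering n * spinOp n 2)) := by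
      rw [h0]
      simp only [smul_mul_assoc, mul_smul_comm, add_mul, mul_add]
      module
    rw [e, hz, hz', h1, hI, smul_smul]
    rw [show I * (-(1 / 2) * I) = 1 / 2 by linear_combination (-(1 / 2) : ℂ) * hII]
    module

theorem casimir_spinOp (n : ℕ) :
    casimir (spinOp n) = ((spin n * (spin n + 1) : ℝ) : ℂ) • (1 : Op n) := by
  have h := (isSpinTriple_spinOp n).down_mul_up
  rw [down_spinOp, up_spinOp, lowering_mul_raising] at h
  have e : casimir (spinOp n) = (Matrix.diagonal fun i : Fin (n + 1) => (i : ℂ) * (n + 1 - i)) +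
      spinOp n 2 * spinOp n 2 + spinOp n 2 := by
    rw [h]; abel
  rw [e, spinOp_two, diagonal_mul_diagonal, diagonal_add, diagonal_add, smul_one_eq_diagonal]
  congr 1
  ext i
  simp only [spin]
  push_cast; ring

theorem isHermitian_spinOp (n : ℕ) (k : Fin 3) : (spinOp n k).IsHermitian := by
  fin_cases k
  · change ((1 / 2 : ℂ) • (raising n + lowering n)).conjTranspose =
      (1 / 2 : ℂ) • (raising n + lowering n)
    rw [conjTranspose_smul, conjTranspose_add, lowering, conjTranspose_conjTranspose,
      add_comm (raising n)]
    simp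
  · change ((1 / (2 * I) : ℂ) • (raising n - lowering n)).conjTranspose =
      (1 / (2 * I) : ℂ) • (raising n - lowering n)
    rw [conjTranspose_smul, conjTranspose_sub, lowering, conjTranspose_conjTranspose]
    have hI : (1 / (2 * I) : ℂ) = -(1 / 2) * I := by
      field_simp [Complex.I_ne_zero]; simp
    have : star (1 / (2 * I) : ℂ) = -(1 / (2 * I)) := by
      rw [hI]; simp
    rw [this, neg_smul, ← smul_neg, neg_sub]
  · change (Matrix.diagonal fun i : Fin (n + 1) => ((spin n - (i : ℝ) : ℝ) : ℂ)).conjTranspose = _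
    rw [diagonal_conjTranspose]
    change _ = (Matrix.diagonal fun i : Fin (n + 1) => ((spin n - (i : ℝ) : ℝ) : ℂ))
    congr 1
    ext i
    exact Complex.conj_ofReal _

theorem map_star_spinOp (n : ℕ) (k : Fin 3) : (spinOp n k).map star = (spinOp n k)ᵀ := by
  conv_rhs => rw [← (isHermitian_spinOp n k).eq]
  rfl

/-! ### The total spin operators -/

theorem totalSpinOp_eq (a b : ℕ) (k : Fin 3) : totalSpinOp a b k =
    Matrix.kronecker (spinOp b k) 1 - Matrix.kronecker 1 (spinOp a k)ᵀ := by
  rw [totalSpinOp, map_star_spinOp]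

/-- Transposition reverses products, and the minus sign in front of the second factor compensates:
`[-Xᵀ, -Yᵀ] = -[X, Y]ᵀ`. The mixed terms commute. -/
theorem totalSpinOp_comm (a b : ℕ) (j k : Fin 3) :
    totalSpinOp a b j * totalSpinOp a b k - totalSpinOp a b k * totalSpinOp a b j =
      Matrix.kronecker (spinOp b j * spinOp b k - spinOp b k * spinOp b j) (1 : Op a) -
      Matrix.kronecker (1 : Op b) (spinOp a j * spinOp a k - spinOp a k * spinOp a j)ᵀ := by
  have hs : ∀ X Y : Op b, Matrix.kronecker (X - Y) (1 : Op a) =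
      Matrix.kronecker X 1 - Matrix.kronecker Y 1 := fun X Y => by
    ext; simp [sub_mul]
  have hs' : ∀ X Y : Op a, Matrix.kronecker (1 : Op b) (X - Y) =
      Matrix.kronecker 1 X - Matrix.kronecker 1 Y := fun X Y => by
    ext; simp [mul_sub]
  rw [hs, transpose_sub, hs']
  simp only [totalSpinOp_eq, sub_mul, mul_sub, transpose_mul, kronecker,
    ← Matrix.mul_kronecker_mul, one_mul, mul_one]
  abel

theorem isSpinTriple_totalSpinOp (a b : ℕ) : IsSpinTriple (totalSpinOp a b) := by
  have hA := isSpinTriple_spinOp a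
  have hB := isSpinTriple_spinOp b
  have hs : ∀ k, Matrix.kronecker (I • spinOp b k) (1 : Op a) -
      Matrix.kronecker (1 : Op b) (I • spinOp a k)ᵀ = I • totalSpinOp a b k := by
    intro k
    rw [totalSpinOp_eq]
    ext
    simp
    ring
  constructor
  · rw [totalSpinOp_comm, hA.xy, hB.xy, hs]
  · rw [totalSpinOp_comm, hA.yz, hB.yz, hs]
  · rw [totalSpinOp_comm, hA.zx, hB.zx, hs]

/-- The spin-spin interaction `∑ₖ J_B^k ⊗ (J_A^k)^*`. -/
def spinSpin (a b : ℕ) : Matrix (Fin (b + 1) × Fin (a + 1)) (Fin (b + 1) × Fin (a + 1)) ℂ :=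
  ∑ k, Matrix.kronecker (spinOp b k) (spinOp a k)ᵀ

theorem casimir_totalSpinOp (a b : ℕ) : casimir (totalSpinOp a b) =
    ((spin b * (spin b + 1) + spin a * (spin a + 1) : ℝ) : ℂ) •
      (1 : Matrix (Fin (b + 1) × Fin (a + 1)) (Fin (b + 1) × Fin (a + 1)) ℂ) -
      (2 : ℂ) • spinSpin a b := by
  have h : ∀ k, totalSpinOp a b k * totalSpinOp a b k =
      Matrix.kronecker (spinOp b k * spinOp b k) (1 : Op a) +
      Matrix.kronecker (1 : Op b) (spinOp a k * spinOp a k)ᵀ -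
      (2 : ℂ) • Matrix.kronecker (spinOp b k) (spinOp a k)ᵀ := by
    intro k
    simp only [totalSpinOp_eq, sub_mul, mul_sub, transpose_mul, kronecker,
      ← Matrix.mul_kronecker_mul, one_mul, mul_one, two_smul]
    abel
  have hB := casimir_spinOp b
  have hA := casimir_spinOp a
  rw [casimir, Fin.sum_univ_three] at hA hB
  rw [casimir, Finset.sum_congr rfl fun k _ => h k, Finset.sum_sub_distrib, Finset.sum_add_distrib,
    ← Finset.smul_sum, spinSpin]
  congr 1
  have e1 : ∑ k, Matrix.kronecker (spinOp b k * spinOp b k) (1 : Op a) =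
      Matrix.kronecker (((spin b * (spin b + 1) : ℝ) : ℂ) • (1 : Op b)) (1 : Op a) := by
    rw [← hB, Fin.sum_univ_three]; ext; simp [add_mul]
  have e2 : ∑ k, Matrix.kronecker (1 : Op b) (spinOp a k * spinOp a k)ᵀ =
      Matrix.kronecker (1 : Op b) (((spin a * (spin a + 1) : ℝ) : ℂ) • (1 : Op a))ᵀ := by
    rw [← hA, Fin.sum_univ_three]; ext; simp [mul_add]
  rw [e1, e2, transpose_smul, transpose_one]
  have e3 : ∀ c d : ℂ, Matrix.kronecker (c • (1 : Op b)) (1 : Op a) +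
      Matrix.kronecker (1 : Op b) (d • (1 : Op a)) = (c + d) • 1 := by
    intro c d
    simp only [kronecker, smul_kronecker, kronecker_smul, one_kronecker_one, add_smul]
  rw [e3, ← Complex.ofReal_add]

theorem isHermitian_totalSpinOp (a b : ℕ) (k : Fin 3) : (totalSpinOp a b k).IsHermitian := by
  rw [totalSpinOp_eq]
  refine IsHermitian.sub ?_ ?_
  · rw [IsHermitian, kronecker, conjTranspose_kronecker, conjTranspose_one,
      (isHermitian_spinOp b k).eq]
  · rw [IsHermitian, kronecker, conjTranspose_kronecker, conjTranspose_one,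
      (isHermitian_spinOp a k).transpose.eq]

/-! ### Weights of the total spin -/

theorem kronecker_apply_prod {m n : ℕ} (A : Op m) (B : Op n) (x y : Fin (m + 1) × Fin (n + 1)) :
    Matrix.kronecker A B x y = A x.1 y.1 * B x.2 y.2 := rfl

/-- The depth of a product basis vector below the highest weight: the total spin `T^z` acts on the
basis vector `x` by `j_A + j_B - depth x`. -/
def depth (a b : ℕ) (x : Fin (b + 1) × Fin (a + 1)) : ℤ := (x.1 : ℤ) + a - (x.2 : ℤ)

theorem depth_nonneg {a b : ℕ} (x : Fin (b + 1) × Fin (a + 1)) : 0 ≤ depth a b x := by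
  have := x.2.2
  simp only [depth]; omega

theorem depth_le {a b : ℕ} (x : Fin (b + 1) × Fin (a + 1)) : depth a b x ≤ a + b := by
  have := x.1.2
  simp only [depth]; omega

theorem depth_eq_zero {a b : ℕ} {x : Fin (b + 1) × Fin (a + 1)} (h : depth a b x = 0) :
    x = (0, Fin.last a) := by
  have := x.2.2
  simp only [depth] at h
  refine Prod.ext (Fin.ext ?_) (Fin.ext ?_)
  · rw [Fin.val_zero]; omega
  · rw [Fin.val_last]; omega

theorem depth_top (a b : ℕ) : depth a b (0, Fin.last a) = 0 := by
  simp [depth]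

theorem down_totalSpinOp (a b : ℕ) : down (totalSpinOp a b) =
    Matrix.kronecker (lowering b) 1 - Matrix.kronecker 1 (lowering a)ᵀ := by
  rw [down, totalSpinOp_eq, totalSpinOp_eq, ← down_spinOp, ← down_spinOp, down, down]
  ext
  simp
  ring

theorem up_totalSpinOp (a b : ℕ) : up (totalSpinOp a b) =
    Matrix.kronecker (raising b) 1 - Matrix.kronecker 1 (raising a)ᵀ := by
  rw [up, totalSpinOp_eq, totalSpinOp_eq, ← up_spinOp, ← up_spinOp, up, up]
  ext
  simp
  ring

/-- `T₋` raises the depth by exactly one: it moves the `B` index up or, because of the transpose,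
the `A` index down. -/
theorem down_totalSpinOp_apply_eq_zero {a b : ℕ} {x y : Fin (b + 1) × Fin (a + 1)}
    (h : depth a b x ≠ depth a b y + 1) : down (totalSpinOp a b) x y = 0 := by
  simp only [depth] at h
  rw [down_totalSpinOp, Matrix.sub_apply, kronecker_apply_prod, kronecker_apply_prod, transpose_apply,
    lowering_apply, lowering_apply]
  by_cases h2 : x.2 = y.2
  · rw [if_neg (by rw [h2] at h; omega), if_neg (by rw [h2]; omega)]
    simp
  · by_cases h1 : x.1 = y.1
    · rw [if_neg (c := (x.2 : ℕ) + 1 = y.2) (by rw [h1] at h; omega), one_apply_ne h2]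
      simp
    · rw [one_apply_ne h1, one_apply_ne h2]
      simp

theorem up_totalSpinOp_apply_eq_zero {a b : ℕ} {x y : Fin (b + 1) × Fin (a + 1)}
    (h : depth a b y ≠ depth a b x + 1) : up (totalSpinOp a b) x y = 0 := by
  simp only [depth] at h
  rw [up_totalSpinOp, Matrix.sub_apply, kronecker_apply_prod, kronecker_apply_prod, transpose_apply]
  simp only [raising, of_apply]
  by_cases h2 : x.2 = y.2
  · rw [if_neg (by rw [h2] at h; omega), if_neg (by rw [h2]; omega)]
    simp
  · by_cases h1 : x.1 = y.1
    · rw [if_neg (c := (y.2 : ℕ) + 1 = x.2) (by rw [h1] at h; omega), one_apply_ne h2]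
      simp
    · rw [one_apply_ne h1, one_apply_ne h2]
      simp

theorem totalSpinOp_two (a b : ℕ) : totalSpinOp a b 2 =
    Matrix.diagonal fun x => ((a + b : ℂ) / 2 - (depth a b x : ℂ)) := by
  ext x y
  rw [totalSpinOp_eq, Matrix.sub_apply, kronecker_apply_prod, kronecker_apply_prod, spinOp_two, spinOp_two,
    diagonal_transpose]
  simp only [diagonal_apply, one_apply, spin, depth, Prod.ext_iff]
  by_cases h1 : x.1 = y.1 <;> by_cases h2 : x.2 = y.2 <;> simp [h1, h2]
  ring

/-- The projector onto the product basis vectors of a given depth. -/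
def depthProjector (a b : ℕ) (w : ℤ) :
    Matrix (Fin (b + 1) × Fin (a + 1)) (Fin (b + 1) × Fin (a + 1)) ℂ :=
  Matrix.diagonal fun x => if depth a b x = w then 1 else 0

theorem depthProjector_mul_down (a b : ℕ) (w : ℤ) :
    depthProjector a b w * down (totalSpinOp a b) =
      down (totalSpinOp a b) * depthProjector a b (w - 1) := by
  ext x y
  rw [depthProjector, depthProjector, diagonal_mul, mul_diagonal]
  by_cases h : depth a b x = depth a b y + 1
  · simp [h, eq_sub_iff_add_eq]
  · simp [down_totalSpinOp_apply_eq_zero h]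

theorem depthProjector_mul_totalSpinOp_two (a b : ℕ) (w : ℤ) :
    depthProjector a b w * totalSpinOp a b 2 =
      ((a + b : ℂ) / 2 - (w : ℂ)) • depthProjector a b w := by
  rw [depthProjector, totalSpinOp_two, diagonal_mul_diagonal, ← diagonal_smul]
  congr 1
  ext x
  by_cases h : depth a b x = w <;> simp [h]

/-- The parameter `s` covers both ladder products: `s = -1` is `T₋ T₊` and `s = 1` is `T₊ T₋`. -/
theorem trace_depthProjector_mul_casimir_sub {a b : ℕ}
    {M : Matrix (Fin (b + 1) × Fin (a + 1)) (Fin (b + 1) × Fin (a + 1)) ℂ}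
    {μ : ℂ} (hM : casimir (totalSpinOp a b) * M = μ • M) (w : ℤ) (s : ℂ) :
    (depthProjector a b w * ((casimir (totalSpinOp a b) - totalSpinOp a b 2 * totalSpinOp a b 2
      + s • totalSpinOp a b 2) * M)).trace =
    (μ - ((a + b : ℂ) / 2 - w) ^ 2 + s * ((a + b : ℂ) / 2 - w)) *
      (depthProjector a b w * M).trace := by
  rw [add_mul, sub_mul, hM, mul_add, mul_sub, smul_mul_assoc, mul_smul_comm, mul_smul_comm,
    mul_assoc (totalSpinOp a b 2), ← mul_assoc _ (totalSpinOp a b 2),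
    depthProjector_mul_totalSpinOp_two, smul_mul_assoc, ← mul_assoc _ (totalSpinOp a b 2),
    depthProjector_mul_totalSpinOp_two]
  simp only [trace_add, trace_sub, trace_smul, smul_mul_assoc, smul_eq_mul]
  ring

/-- Operators that commute with the lowering operator have equal traces on neighbouring weight
spaces of a fixed total angular momentum. -/
theorem trace_depthProjector_step {a b : ℕ}
    {M : Matrix (Fin (b + 1) × Fin (a + 1)) (Fin (b + 1) × Fin (a + 1)) ℂ}
    (hd : Commute (down (totalSpinOp a b)) M)
    {μ : ℂ} (hM : casimir (totalSpinOp a b) * M = μ • M) (w : ℤ) :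
    (μ - ((a + b : ℂ) / 2 - w) * ((a + b : ℂ) / 2 - w + 1)) * (depthProjector a b w * M).trace =
    (μ - ((a + b : ℂ) / 2 - w) * ((a + b : ℂ) / 2 - w + 1)) *
      (depthProjector a b (w - 1) * M).trace := by
  have h := isSpinTriple_totalSpinOp a b
  -- Move `T₋` to the left past the weight projector, which shifts the depth, then around the trace
  -- and through `M`.
  have e : (depthProjector a b w * (down (totalSpinOp a b) * up (totalSpinOp a b) * M)).trace =
      (depthProjector a b (w - 1) * (up (totalSpinOp a b) * down (totalSpinOp a b) * M)).trace := by
    rw [mul_assoc, ← mul_assoc, depthProjector_mul_down, mul_assoc, trace_mul_comm, mul_assoc,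
      mul_assoc, ← hd.eq, mul_assoc]
  -- With `m` the weight at depth `w`, both ladder products have the coefficient `μ - m(m+1)`, since
  -- `(m+1)² - (m+1) = m(m+1)`.
  have h1 := trace_depthProjector_mul_casimir_sub hM w (-1)
  have h2 := trace_depthProjector_mul_casimir_sub hM (w - 1) 1
  rw [neg_smul, one_smul, ← sub_eq_add_neg, ← h.down_mul_up, e] at h1
  rw [one_smul, ← h.up_mul_down, h1] at h2
  push_cast at h2
  linear_combination h2

theorem sum_trace_depthProjector (a b : ℕ)
    (M : Matrix (Fin (b + 1) × Fin (a + 1)) (Fin (b + 1) × Fin (a + 1)) ℂ) :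
    M.trace = ∑ w ∈ Finset.range (a + b + 1), (depthProjector a b w * M).trace := by
  rw [← trace_sum, ← Finset.sum_mul]
  have : ∑ w ∈ Finset.range (a + b + 1), depthProjector a b (w : ℤ) = 1 := by
    ext x y
    rw [Matrix.sum_apply]
    simp only [depthProjector, diagonal_apply, one_apply]
    by_cases hxy : x = y
    · subst hxy
      simp only [↓reduceIte]
      have h0 := depth_nonneg x
      have h1 := depth_le x
      rw [Finset.sum_eq_single (depth a b x).toNat]
      · rw [if_pos (by omega)]
      · intro w _ hw
        rw [if_neg (by omega)]
      · intro hw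
        simp only [Finset.mem_range] at hw
        omega
    · simp [hxy]
  rw [this, one_mul]

theorem trace_depthProjector_neg_one (a b : ℕ)
    (M : Matrix (Fin (b + 1) × Fin (a + 1)) (Fin (b + 1) × Fin (a + 1)) ℂ) :
    (depthProjector a b (-1) * M).trace = 0 := by
  have : depthProjector a b (-1) = 0 := by
    rw [depthProjector, diagonal_eq_zero]
    ext x
    have := depth_nonneg x
    simp only [Pi.zero_apply, ite_eq_right_iff]
    omega
  rw [this, zero_mul, trace_zero]

theorem trace_depthProjector_zero (a b : ℕ)
    (M : Matrix (Fin (b + 1) × Fin (a + 1)) (Fin (b + 1) × Fin (a + 1)) ℂ) :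
    (depthProjector a b 0 * M).trace = M (0, Fin.last a) (0, Fin.last a) := by
  rw [trace, Finset.sum_eq_single (0, Fin.last a)]
  · simp [depthProjector, diag, diagonal_mul, depth_top]
  · intro x _ hx
    rw [diag, depthProjector, diagonal_mul, if_neg (fun h => hx (depth_eq_zero h)), zero_mul]
  · simp

/-- An operator of the commutant supported on total angular momentum above `j_A + j_B` has no
trace. -/
theorem trace_eq_zero_of_casimir_gt {a b : ℕ}
    {M : Matrix (Fin (b + 1) × Fin (a + 1)) (Fin (b + 1) × Fin (a + 1)) ℂ}
    (hd : Commute (down (totalSpinOp a b)) M)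
    {μ : ℝ} (hμ : spin (a + b) * (spin (a + b) + 1) < μ)
    (hM : casimir (totalSpinOp a b) * M = (μ : ℂ) • M) : M.trace = 0 := by
  have h : ∀ w : ℕ, w < a + b + 1 → (depthProjector a b (w : ℤ) * M).trace = 0 := by
    intro w
    induction w with
    | zero =>
      intro _
      have := trace_depthProjector_step hd hM 0
      rw [zero_sub, trace_depthProjector_neg_one, mul_zero, mul_eq_zero] at this
      refine this.resolve_left ?_
      rw [spin] at hμ
      push_cast at hμ
      intro h0
      have : μ - ((a + b : ℝ) / 2) * ((a + b : ℝ) / 2 + 1) = 0 := by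
        apply Complex.ofReal_injective
        push_cast
        simpa using h0
      linarith
    | succ w ih =>
      intro hw
      have := trace_depthProjector_step hd hM (w + 1)
      rw [add_sub_cancel_right, ih (by omega), mul_zero, mul_eq_zero] at this
      push_cast
      refine this.resolve_left ?_
      rw [spin] at hμ
      push_cast at hμ
      intro h0
      have h0 : μ - ((a + b : ℝ) / 2 - (w + 1)) * ((a + b : ℝ) / 2 - (w + 1) + 1) = 0 := by
        apply Complex.ofReal_injective
        push_cast
        simpa using h0
      -- The weight `m = L - (w+1)` lies in `[-L, L]`, where `m(m+1) ≤ L(L+1) < μ`, so the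
      -- coefficient cannot vanish.
      have hw' : (w : ℝ) + 1 ≤ a + b := by exact_mod_cast (by omega : w + 1 ≤ a + b)
      nlinarith
  rw [sum_trace_depthProjector, Finset.sum_eq_zero]
  intro w hw
  exact h w (Finset.mem_range.1 hw)

/-- The trace of an operator of the commutant supported on total angular momentum `j_A + j_B`
is determined by its expectation in the highest weight vector. -/
theorem trace_eq_of_casimir_eq {a b : ℕ}
    {M : Matrix (Fin (b + 1) × Fin (a + 1)) (Fin (b + 1) × Fin (a + 1)) ℂ}
    (hd : Commute (down (totalSpinOp a b)) M)
    (hM : casimir (totalSpinOp a b) * M =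
      ((spin (a + b) * (spin (a + b) + 1) : ℝ) : ℂ) • M) :
    M.trace = (a + b + 1) * M (0, Fin.last a) (0, Fin.last a) := by
  have h : ∀ w : ℕ, w < a + b + 1 →
      (depthProjector a b (w : ℤ) * M).trace = M (0, Fin.last a) (0, Fin.last a) := by
    intro w
    induction w with
    | zero => intro _; exact trace_depthProjector_zero a b M
    | succ w ih =>
      intro hw
      have := trace_depthProjector_step hd hM (w + 1)
      rw [add_sub_cancel_right, ih (by omega)] at this
      push_cast
      refine mul_left_cancel₀ ?_ this
      -- The coefficient factors as `(L - m)(L + m + 1)` with `m = L - (w+1)`; it vanishes only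
      -- below the lowest weight.
      have e : ((spin (a + b) * (spin (a + b) + 1) : ℝ) : ℂ) -
          ((a + b : ℂ) / 2 - ((w + 1 : ℤ) : ℂ)) * ((a + b : ℂ) / 2 - ((w + 1 : ℤ) : ℂ) + 1) =
          ((w : ℂ) + 1) * ((a + b : ℂ) - w) := by
        rw [spin]; push_cast; ring
      rw [e]
      refine mul_ne_zero (Nat.cast_add_one_ne_zero w) (sub_ne_zero.2 ?_)
      exact_mod_cast (by omega : a + b ≠ w)
  rw [sum_trace_depthProjector, Finset.sum_congr rfl fun w hw => h w (Finset.mem_range.1 hw)]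
  simp

/-! ### Spectral projectors -/

section EigenProjector

variable {ι : Type*} [Fintype ι] [DecidableEq ι]

/-- The matrix of the orthogonal projector onto an eigenspace of a matrix. -/
def eigenProjector (H : Matrix ι ι ℂ) (μ : ℂ) : Matrix ι ι ℂ :=
  Matrix.toEuclideanLin.symm ((Module.End.eigenspace (Matrix.toEuclideanLin H) μ).starProjection :
    EuclideanSpace ℂ ι →ₗ[ℂ] EuclideanSpace ℂ ι)

theorem toEuclideanLin_eigenProjector (H : Matrix ι ι ℂ) (μ : ℂ) :
    Matrix.toEuclideanLin (eigenProjector H μ) =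
      ((Module.End.eigenspace (Matrix.toEuclideanLin H) μ).starProjection :
        EuclideanSpace ℂ ι →ₗ[ℂ] EuclideanSpace ℂ ι) :=
  LinearEquiv.apply_symm_apply _ _

theorem isHermitian_eigenProjector (H : Matrix ι ι ℂ) (μ : ℂ) :
    (eigenProjector H μ).IsHermitian := by
  rw [← Matrix.isSymmetric_toEuclideanLin_iff, toEuclideanLin_eigenProjector]
  exact Submodule.starProjection_isSymmetric (K := Module.End.eigenspace (Matrix.toEuclideanLin H) μ)

theorem mul_eigenProjector (H : Matrix ι ι ℂ) (μ : ℂ) :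
    H * eigenProjector H μ = μ • eigenProjector H μ := by
  apply Matrix.toEuclideanLin.injective
  rw [toLpLin_mul_same, map_smul, toEuclideanLin_eigenProjector]
  ext1 v
  have := Submodule.starProjection_apply_mem
    (Module.End.eigenspace (Matrix.toEuclideanLin H) μ) v
  exact Module.End.mem_eigenspace_iff.1 this

/-- The columns of `X` lie in the eigenspace, which the projector fixes pointwise. -/
theorem eigenProjector_mul_of_mul_eq_smul {H : Matrix ι ι ℂ} {μ : ℂ} {X : Matrix ι ι ℂ}
    (hX : H * X = μ • X) : eigenProjector H μ * X = X := by
  apply Matrix.toEuclideanLin.injective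
  rw [toLpLin_mul_same, toEuclideanLin_eigenProjector]
  ext1 v
  refine Submodule.starProjection_eq_self_iff.2 (Module.End.mem_eigenspace_iff.2 ?_)
  have := congrArg (fun Y => Matrix.toEuclideanLin Y v) hX
  rw [toLpLin_mul_same, map_smul] at this
  exact this

theorem eigenProjector_mul_self (H : Matrix ι ι ℂ) (μ : ℂ) :
    eigenProjector H μ * eigenProjector H μ = eigenProjector H μ :=
  eigenProjector_mul_of_mul_eq_smul (mul_eigenProjector H μ)

/-- `N` preserves the eigenspace, so `P N P = N P`; taking adjoints gives `P N P = P N`. -/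
theorem commute_eigenProjector {H N : Matrix ι ι ℂ} (μ : ℂ) (hN : N.IsHermitian)
    (hNH : Commute N H) : Commute N (eigenProjector H μ) := by
  have h : eigenProjector H μ * (N * eigenProjector H μ) = N * eigenProjector H μ := by
    apply eigenProjector_mul_of_mul_eq_smul
    rw [← mul_assoc, ← hNH.eq, mul_assoc, mul_eigenProjector, mul_smul_comm]
  have h' := congrArg conjTranspose h
  simp only [conjTranspose_mul, hN.eq, (isHermitian_eigenProjector H μ).eq] at h'
  rw [commute_iff_eq, ← h, ← mul_assoc, h']

end EigenProjector

/-! ### The subspace of highest total angular momentum -/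

theorem irrepProjector_eq (a b c : ℕ) : irrepProjector a b c =
    eigenProjector (casimir (totalSpinOp a b)) ((spin c * (spin c + 1) : ℝ) : ℂ) := rfl

theorem isHermitian_casimir (a b : ℕ) : (casimir (totalSpinOp a b)).IsHermitian := by
  rw [casimir, Fin.sum_univ_three]
  have h : ∀ k, (totalSpinOp a b k * totalSpinOp a b k).IsHermitian := fun k => by
    rw [IsHermitian, conjTranspose_mul, (isHermitian_totalSpinOp a b k).eq]
  exact ((h 0).add (h 1)).add (h 2)

theorem commute_totalSpinOp_eigenProjector (a b : ℕ) (μ : ℂ) (k : Fin 3) :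
    Commute (totalSpinOp a b k) (eigenProjector (casimir (totalSpinOp a b)) μ) :=
  commute_eigenProjector μ (isHermitian_totalSpinOp a b k)
    ((isSpinTriple_totalSpinOp a b).commute_casimir k)

theorem commute_down_of_commute {a b : ℕ}
    {M : Matrix (Fin (b + 1) × Fin (a + 1)) (Fin (b + 1) × Fin (a + 1)) ℂ}
    (h : ∀ k, Commute (totalSpinOp a b k) M) : Commute (down (totalSpinOp a b)) M :=
  (h 0).sub_left ((h 1).smul_left I)

/-- The top product vector is killed by `T₊` and has weight `L`, so `T² = T₋ T₊ + T_z² + T_z` acts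
on it by `L(L+1)`. -/
theorem casimir_mul_single_top (a b : ℕ) :
    casimir (totalSpinOp a b) * Matrix.single (0, Fin.last a) (0, Fin.last a) 1 =
      ((spin (a + b) * (spin (a + b) + 1) : ℝ) : ℂ) •
        Matrix.single (0, Fin.last a) (0, Fin.last a) 1 := by
  have h := (isSpinTriple_totalSpinOp a b).down_mul_up
  have e : casimir (totalSpinOp a b) = down (totalSpinOp a b) * up (totalSpinOp a b) +
      totalSpinOp a b 2 * totalSpinOp a b 2 + totalSpinOp a b 2 := by
    rw [h]; abel
  have h0 : up (totalSpinOp a b) * Matrix.single (0, Fin.last a) (0, Fin.last a) (1 : ℂ) = 0 := by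
    ext x y
    by_cases hy : y = (0, Fin.last a)
    · subst hy
      rw [mul_single_apply_same, up_totalSpinOp_apply_eq_zero, zero_mul, Matrix.zero_apply]
      rw [depth_top]
      have := depth_nonneg x
      omega
    · rw [mul_single_apply_of_ne _ _ _ _ _ hy, Matrix.zero_apply]
  have h1 : totalSpinOp a b 2 * Matrix.single (0, Fin.last a) (0, Fin.last a) (1 : ℂ) =
      (spin (a + b) : ℂ) • Matrix.single (0, Fin.last a) (0, Fin.last a) (1 : ℂ) := by
    ext x y
    rw [totalSpinOp_two, diagonal_mul, Matrix.smul_apply]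
    by_cases hx : x = (0, Fin.last a)
    · subst hx
      rw [depth_top, spin]
      push_cast
      simp
    · simp [Matrix.single, Ne.symm hx]
  rw [e, add_mul, add_mul, mul_assoc, h0, mul_zero, zero_add, mul_assoc, h1, mul_smul_comm, h1]
  push_cast
  module

theorem irrepProjector_apply_top (a b : ℕ) :
    irrepProjector a b (a + b) (0, Fin.last a) (0, Fin.last a) = 1 := by
  have h := eigenProjector_mul_of_mul_eq_smul (casimir_mul_single_top a b)
  have := congrFun (congrFun h (0, Fin.last a)) (0, Fin.last a)
  rw [mul_single_apply_same, mul_one, single_apply_same] at this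
  exact this

theorem trace_irrepProjector (a b : ℕ) : (irrepProjector a b (a + b)).trace = a + b + 1 := by
  have h : (irrepProjector a b (a + b)).trace = _ := trace_eq_of_casimir_eq
    (commute_down_of_commute (commute_totalSpinOp_eigenProjector a b _)) (mul_eigenProjector _ _)
  rw [h, irrepProjector_apply_top, mul_one]

theorem posSemidef_irrepProjector (a b c : ℕ) : (irrepProjector a b c).PosSemidef := by
  rw [irrepProjector_eq, ← eigenProjector_mul_self]
  conv in (occs := 1) eigenProjector _ _ => rw [← (isHermitian_eigenProjector _ _).eq]
  exact posSemidef_conjTranspose_mul_self _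

/-- The gap `L (L + 1) - T²` below the highest total angular momentum `L = j_A + j_B`. -/
def casimirGap (a b : ℕ) : Matrix (Fin (b + 1) × Fin (a + 1)) (Fin (b + 1) × Fin (a + 1)) ℂ :=
  ((spin (a + b) * (spin (a + b) + 1) : ℝ) : ℂ) • 1 - casimir (totalSpinOp a b)

/-- The constant is `L(L+1) - j_A(j_A+1) - j_B(j_B+1) = 2 j_A j_B`. -/
theorem casimirGap_eq (a b : ℕ) : casimirGap a b =
    (2 : ℂ) • (spinSpin a b + ((spin a * spin b : ℝ) : ℂ) • 1) := by
  rw [casimirGap, casimir_totalSpinOp, sub_sub_eq_add_sub, add_sub_right_comm, ← sub_smul, smul_add,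
    smul_smul, add_comm _ (_ • spinSpin a b)]
  congr 2
  simp only [spin]
  push_cast
  ring

theorem isHermitian_casimirGap (a b : ℕ) : (casimirGap a b).IsHermitian := by
  refine IsHermitian.sub ?_ (isHermitian_casimir a b)
  rw [IsHermitian, conjTranspose_smul, conjTranspose_one, Complex.star_def, Complex.conj_ofReal]

/-- The total angular momentum is at most `j_A + j_B`. -/
theorem posSemidef_casimirGap (a b : ℕ) : (casimirGap a b).PosSemidef := by
  have hH := isHermitian_casimirGap a b
  rw [hH.posSemidef_iff_eigenvalues_nonneg]
  intro i
  by_contra hneg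
  rw [not_le, Pi.zero_apply] at hneg
  set ν := hH.eigenvalues i with hν
  set v : Fin (b + 1) × Fin (a + 1) → ℂ := ⇑(hH.eigenvectorBasis i) with hv
  have hev : casimirGap a b *ᵥ v = (ν : ℂ) • v := hH.mulVec_eigenvectorBasis i
  set l : ℝ := spin (a + b) * (spin (a + b) + 1) with hl
  have hT : casimir (totalSpinOp a b) *ᵥ v = ((l - ν : ℝ) : ℂ) • v := by
    rw [casimirGap, sub_mulVec, smul_mulVec, one_mulVec] at hev
    push_cast
    rw [sub_smul, ← hev, sub_sub_cancel]
  have hX : casimir (totalSpinOp a b) * vecMulVec v (star v) =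
      ((l - ν : ℝ) : ℂ) • vecMulVec v (star v) := by
    rw [mul_vecMulVec, hT, smul_vecMulVec]
  have hP := eigenProjector_mul_of_mul_eq_smul hX
  set P := eigenProjector (casimir (totalSpinOp a b)) ((l - ν : ℝ) : ℂ) with hPdef
  -- A negative eigenvalue `ν` of the gap would put `v` in the eigenspace of `T²` for `L(L+1) - ν >
  -- L(L+1)`, whose projector has trace zero and so vanishes.
  have htr : P.trace = 0 := trace_eq_zero_of_casimir_gt
    (commute_down_of_commute (commute_totalSpinOp_eigenProjector a b _))
    (by linarith) (mul_eigenProjector _ _)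
  have hP0 : P = 0 := by
    rw [← trace_conjTranspose_mul_self_eq_zero_iff, (isHermitian_eigenProjector _ _).eq,
      eigenProjector_mul_self, htr]
  rw [hP0, zero_mul] at hP
  have hv0 : v = 0 := by
    ext x
    have := congrFun (congrFun hP x) x
    simpa [vecMulVec_apply] using this.symm
  have hne := hH.eigenvectorBasis.orthonormal.ne_zero i
  apply hne
  ext x
  exact congrFun hv0 x

/-! ### Traces of products of positive matrices -/

section PosSemidef

variable {ι : Type*} [Fintype ι]

theorem trace_vecMulVec_mul_eq (v : ι → ℂ) (B : Matrix ι ι ℂ) :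
    (vecMulVec v (star v) * B).trace = star v ⬝ᵥ B *ᵥ v := by
  rw [trace_mul_comm, mul_vecMulVec, trace_vecMulVec, dotProduct_comm]

theorem trace_mul_nonneg_of_posSemidef {A B : Matrix ι ι ℂ} (hA : A.PosSemidef)
    (hB : B.PosSemidef) : 0 ≤ (A * B).trace := by
  obtain ⟨m, v, rfl⟩ := posSemidef_iff_eq_sum_vecMulVec.1 hA
  rw [Finset.sum_mul, trace_sum]
  refine Finset.sum_nonneg fun i _ => ?_
  rw [trace_vecMulVec_mul_eq]
  exact hB.dotProduct_mulVec_nonneg (v i)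

/-- Split `A` into rank-one terms `v v†`. Each `v† B v` is nonnegative and they sum to zero, so all
vanish, and positivity of `B` gives `B v = 0`. -/
theorem mul_eq_zero_of_trace_mul_eq_zero {A B : Matrix ι ι ℂ} (hA : A.PosSemidef)
    (hB : B.PosSemidef) (h : (A * B).trace = 0) : B * A = 0 := by
  obtain ⟨m, v, rfl⟩ := posSemidef_iff_eq_sum_vecMulVec.1 hA
  rw [Finset.sum_mul, trace_sum, Finset.sum_eq_zero_iff_of_nonneg] at h
  · rw [Finset.mul_sum]
    refine Finset.sum_eq_zero fun i hi => ?_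
    have := h i hi
    rw [trace_vecMulVec_mul_eq, hB.dotProduct_mulVec_zero_iff] at this
    rw [mul_vecMulVec, this, zero_vecMulVec]
  · intro i _
    rw [trace_vecMulVec_mul_eq]
    exact hB.dotProduct_mulVec_nonneg (v i)

end PosSemidef

/-- The commutant is one-dimensional on the subspace of highest total angular momentum. -/
theorem eq_smul_irrepProjector {a b : ℕ}
    {C : Matrix (Fin (b + 1) × Fin (a + 1)) (Fin (b + 1) × Fin (a + 1)) ℂ}
    (hC : C.IsHermitian) (hT : ∀ k, Commute (totalSpinOp a b k) C) (h0 : casimirGap a b * C = 0) :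
    C = C (0, Fin.last a) (0, Fin.last a) • irrepProjector a b (a + b) := by
  set t : Fin (b + 1) × Fin (a + 1) := (0, Fin.last a) with ht
  set l : ℂ := ((spin (a + b) * (spin (a + b) + 1) : ℝ) : ℂ) with hl
  set P := irrepProjector a b (a + b) with hP
  have hcas : casimir (totalSpinOp a b) * C = l • C := by
    rw [casimirGap, sub_mul, smul_mul_assoc, one_mul, sub_eq_zero] at h0
    exact h0.symm
  have hPH : P.IsHermitian := isHermitian_eigenProjector _ _
  -- The multiple of `P` is chosen to cancel the top entry of `C`; the claim is `D = 0`.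
  set D := C - C t t • P with hD
  have hcasD : casimir (totalSpinOp a b) * D = l • D := by
    rw [hD, mul_sub, hcas, mul_smul_comm, hP, irrepProjector_eq, mul_eigenProjector, smul_sub,
      smul_comm]
  have hTD : ∀ k, Commute (totalSpinOp a b k) D := fun k =>
    (hT k).sub_right ((commute_totalSpinOp_eigenProjector a b _ k).smul_right _)
  have hDH : D.IsHermitian := by
    have hr : star (C t t) = C t t := hC.apply t t
    rw [hD, IsHermitian, conjTranspose_sub, conjTranspose_smul, hC.eq, hPH.eq, hr]
  -- `D` preserves weights and `t` is the only basis vector of depth zero, so the column of `t` can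
  -- only have its diagonal entry.
  have hDt : ∀ x, D x t = 0 := by
    intro x
    by_cases hx : x = t
    · rw [hx, hD, Matrix.sub_apply, Matrix.smul_apply, hP, ht, irrepProjector_apply_top,
        smul_eq_mul, mul_one, sub_self]
    · have h := congrFun (congrFun (hTD 2).eq x) t
      rw [totalSpinOp_two, diagonal_mul, mul_diagonal, depth_top] at h
      have h2 : (depth a b x : ℂ) * D x t = 0 := by
        push_cast at h
        linear_combination -h
      refine (mul_eq_zero.1 h2).resolve_left ?_
      exact_mod_cast fun h => hx (depth_eq_zero h)
  -- `D²` again commutes with `T` and lives at `L(L+1)`, so its trace is a multiple of its top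
  -- entry, which involves only the zero column.
  have htr : (Dᴴ * D).trace = 0 := by
    rw [hDH.eq, trace_eq_of_casimir_eq
      (commute_down_of_commute fun k => (hTD k).mul_right (hTD k))
      (by rw [← mul_assoc, hcasD, smul_mul_assoc]), Matrix.mul_apply,
      Finset.sum_eq_zero (fun x _ => by rw [hDt x, mul_zero]), mul_zero]
  rw [trace_conjTranspose_mul_self_eq_zero_iff] at htr
  exact sub_eq_zero.1 htr

/-! ### Choi matrices -/

/-- The Choi matrix `∑ E(|k⟩⟨l|) ⊗ |k⟩⟨l|`. -/
def choi {a b : ℕ} (E : SuperOp a b) :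
    Matrix (Fin (b + 1) × Fin (a + 1)) (Fin (b + 1) × Fin (a + 1)) ℂ :=
  Matrix.of fun x y => E (Matrix.single x.2 y.2 1) x.1 y.1

/-- The superoperator with a given Choi matrix. -/
def ofChoi {a b : ℕ} (C : Matrix (Fin (b + 1) × Fin (a + 1)) (Fin (b + 1) × Fin (a + 1)) ℂ) :
    SuperOp a b where
  toFun X := Matrix.of fun i j => ∑ k, ∑ l, C (i, k) (j, l) * X k l
  map_add' X Y := by
    ext i j
    simp [mul_add, Finset.sum_add_distrib]
  map_smul' c X := by
    ext i j
    simp only [Matrix.smul_apply, smul_eq_mul, of_apply, RingHom.id_apply, Finset.mul_sum]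
    exact Finset.sum_congr rfl fun k _ => Finset.sum_congr rfl fun l _ => by ring

theorem ofChoi_apply {a b : ℕ}
    (C : Matrix (Fin (b + 1) × Fin (a + 1)) (Fin (b + 1) × Fin (a + 1)) ℂ) (X : Op a)
    (i j : Fin (b + 1)) : ofChoi C X i j = ∑ k, ∑ l, C (i, k) (j, l) * X k l := rfl

theorem apply_eq_sum_choi {a b : ℕ} (E : SuperOp a b) (X : Op a) (i j : Fin (b + 1)) :
    E X i j = ∑ k, ∑ l, choi E (i, k) (j, l) * X k l := by
  conv_lhs => rw [matrix_eq_sum_single X]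
  simp only [map_sum, Matrix.sum_apply]
  refine Finset.sum_congr rfl fun k _ => Finset.sum_congr rfl fun l _ => ?_
  have : Matrix.single k l (X k l) = X k l • Matrix.single k l (1 : ℂ) := by
    rw [smul_single, smul_eq_mul, mul_one]
  rw [this, map_smul, Matrix.smul_apply, smul_eq_mul, mul_comm]
  rfl

theorem ofChoi_choi {a b : ℕ} (E : SuperOp a b) : ofChoi (choi E) = E := by
  ext1 X
  ext i j
  rw [ofChoi_apply, apply_eq_sum_choi E]

theorem choi_ofChoi {a b : ℕ}
    (C : Matrix (Fin (b + 1) × Fin (a + 1)) (Fin (b + 1) × Fin (a + 1)) ℂ) :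
    choi (ofChoi C) = C := by
  ext x y
  rw [choi, of_apply, ofChoi_apply, Finset.sum_eq_single x.2, Finset.sum_eq_single y.2]
  · simp
  · intro l _ hl
    simp [Matrix.single, Ne.symm hl]
  · simp
  · intro k _ hk
    simp [Matrix.single, Ne.symm hk]
  · simp

theorem choi_injective {a b : ℕ} : Function.Injective (choi : SuperOp a b → _) := fun E F h => by
  rw [← ofChoi_choi E, h, ofChoi_choi]

theorem jamiolkowski_eq {a b : ℕ} (E : SuperOp a b) :
    jamiolkowski E = ((a : ℂ) + 1)⁻¹ • choi E := by
  ext x y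
  have h : (Matrix.of fun i j : Fin (a + 1) => vecMulVec (maxEntangled a) (star (maxEntangled a))
      (i, x.2) (j, y.2)) = ((a : ℂ) + 1)⁻¹ • Matrix.single x.2 y.2 (1 : ℂ) := by
    have hs : ((1 / Real.sqrt ((a : ℝ) + 1) : ℝ) : ℂ) * ((1 / Real.sqrt ((a : ℝ) + 1) : ℝ) : ℂ) =
        ((a : ℂ) + 1)⁻¹ := by
      rw [← Complex.ofReal_mul, div_mul_div_comm, Real.mul_self_sqrt (by positivity)]
      push_cast
      simp
    ext i j
    rw [of_apply, vecMulVec_apply, Pi.star_apply, maxEntangled, maxEntangled, Matrix.smul_apply,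
      Matrix.single, of_apply]
    by_cases h1 : i = x.2 <;> by_cases h2 : j = y.2
    · simp only [h1, h2, if_true, and_self, Complex.star_def, Complex.conj_ofReal, hs, smul_eq_mul,
        mul_one]
    · simp [h2, Ne.symm h2]
    · simp [h1, Ne.symm h1]
    · simp [h1, Ne.symm h1]
  rw [jamiolkowski, ampliation, of_apply, h, map_smul]
  rfl

theorem posSemidef_choi {a b : ℕ} {E : SuperOp a b} (hE : IsCompletelyPositive E) :
    (choi E).PosSemidef := by
  have h : (jamiolkowski E).PosSemidef := hE (a + 1) _ (posSemidef_vecMulVec_self_star _)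
  have e : choi E = ((a : ℂ) + 1) • jamiolkowski E := by
    rw [jamiolkowski_eq, smul_smul, mul_inv_cancel₀ (Nat.cast_add_one_ne_zero a), one_smul]
  rw [e]
  exact h.smul (by positivity)

/-- Choi's theorem: a rank-one decomposition of `C` yields Kraus operators. -/
theorem isCompletelyPositive_ofChoi {a b : ℕ}
    {C : Matrix (Fin (b + 1) × Fin (a + 1)) (Fin (b + 1) × Fin (a + 1)) ℂ} (hC : C.PosSemidef) :
    IsCompletelyPositive (ofChoi C) := by
  intro r X hX
  obtain ⟨m, v, rfl⟩ := posSemidef_iff_eq_sum_vecMulVec.1 hC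
  -- The vector `v z`, read as a matrix from `ℋ_A` to `ℋ_B`, tensored with the identity on the
  -- ancilla.
  let K : Fin m → Matrix (Fin (b + 1) × Fin r) (Fin (a + 1) × Fin r) ℂ := fun z =>
    Matrix.of fun p q => if p.2 = q.2 then v z (p.1, q.1) else 0
  have e : ampliation (Fin r) (ofChoi (∑ z, vecMulVec (v z) (star (v z)))) X =
      ∑ z, K z * X * (K z)ᴴ := by
    ext p q
    rw [ampliation, of_apply, ofChoi_apply, Matrix.sum_apply]
    have hK : ∀ z, (K z * X * (K z)ᴴ) p q =
        ∑ k, ∑ l, v z (p.1, k) * star (v z (q.1, l)) * X (k, p.2) (l, q.2) := by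
      intro z
      have h1 : ∀ y, (K z * X) p y = ∑ k, v z (p.1, k) * X (k, p.2) y := by
        intro y
        rw [Matrix.mul_apply, Fintype.sum_prod_type]
        refine Finset.sum_congr rfl fun k _ => ?_
        simp [K]
      rw [Matrix.mul_apply, Fintype.sum_prod_type]
      simp only [h1, conjTranspose_apply, K, of_apply, apply_ite star, star_zero, mul_ite, mul_zero,
        Finset.sum_ite_eq, Finset.mem_univ, if_true, Finset.sum_mul]
      rw [Finset.sum_comm]
      refine Finset.sum_congr rfl fun k _ => Finset.sum_congr rfl fun l _ => ?_
      ring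
    simp only [hK, Matrix.sum_apply, vecMulVec_apply, Pi.star_apply, of_apply, Finset.sum_mul]
    symm
    rw [Finset.sum_comm]
    exact Finset.sum_congr rfl fun k _ => Finset.sum_comm
  rw [e]
  exact posSemidef_sum _ fun z _ => hX.mul_mul_conjTranspose_same (K z)

/-! ### Dual maps -/

/-- The dual map with respect to the trace pairing. -/
def dual {a b : ℕ} (E : SuperOp a b) : Op b →ₗ[ℂ] Op a where
  toFun Y := Matrix.of fun l k => (Y * E (Matrix.single k l 1)).trace
  map_add' Y Z := by
    ext
    simp [add_mul]
  map_smul' c Y := by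
    ext
    simp

theorem trace_dual_mul {a b : ℕ} (E : SuperOp a b) (Y : Op b) (X : Op a) :
    (dual E Y * X).trace = (Y * E X).trace := by
  conv_rhs => rw [matrix_eq_sum_single X]
  simp only [map_sum, Finset.mul_sum, trace_sum]
  rw [trace, Finset.sum_comm]
  simp only [diag, Matrix.mul_apply]
  refine Finset.sum_congr rfl fun l _ => Finset.sum_congr rfl fun k _ => ?_
  have : Matrix.single k l (X k l) = X k l • Matrix.single k l (1 : ℂ) := by
    rw [smul_single, smul_eq_mul, mul_one]
  rw [this, map_smul, mul_smul_comm, trace_smul, smul_eq_mul, mul_comm]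
  rfl

theorem eq_of_trace_mul_eq {n : ℕ} {A B : Op n} (h : ∀ X : Op n, (A * X).trace = (B * X).trace) :
    A = B := by
  ext i j
  have := h (Matrix.single j i 1)
  simpa [trace_mul_single] using this

/-- This turns expectations of the spin-spin interaction in the Choi matrix into traces of `J_B^k
E(J_A^k)`. -/
theorem trace_choi_mul_kronecker {a b : ℕ} (E : SuperOp a b) (X : Op b) (Y : Op a) :
    (choi E * Matrix.kronecker X Yᵀ).trace = (X * E Y).trace := by
  simp only [trace, diag, Matrix.mul_apply, Fintype.sum_prod_type, kronecker_apply_prod,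
    transpose_apply, apply_eq_sum_choi E Y, Finset.mul_sum]
  rw [Finset.sum_comm (s := Finset.univ (α := Fin (b + 1))) (t := Finset.univ (α := Fin (b + 1)))]
  refine Finset.sum_congr rfl fun i _ => ?_
  rw [Finset.sum_comm]
  exact Finset.sum_congr rfl fun j _ => Finset.sum_congr rfl fun k _ =>
    Finset.sum_congr rfl fun l _ => by ring

/-! ### Infinitesimal covariance -/

/-- Covariance under the Lie algebra of `SU(2)`. -/
def IsInfCovariant {a b : ℕ} (E : SuperOp a b) : Prop :=
  ∀ k X, spinOp b k * E X - E X * spinOp b k = E (spinOp a k * X - X * spinOp a k)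

/-- The generator `i J · g` of a rotation. -/
def rotationGen (n : ℕ) (g : Fin 3 → ℝ) : Op n := I • ∑ k, (g k : ℂ) • spinOp n k

theorem rotation_smul (n : ℕ) (g : Fin 3 → ℝ) (t : ℝ) :
    rotation n (t • g) = NormedSpace.exp (t • rotationGen n g) := by
  rw [rotation, rotationGen]
  congr 1
  rw [smul_comm t I, Finset.smul_sum (r := t)]
  congr 1
  refine Finset.sum_congr rfl fun k _ => ?_
  rw [Pi.smul_apply, smul_eq_mul, Complex.ofReal_mul, mul_smul]
  rfl

theorem conjTranspose_rotationGen (n : ℕ) (g : Fin 3 → ℝ) :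
    (rotationGen n g)ᴴ = -rotationGen n g := by
  rw [rotationGen, conjTranspose_smul, conjTranspose_sum, Complex.star_def, Complex.conj_I,
    neg_smul]
  congr 2
  refine Finset.sum_congr rfl fun k _ => ?_
  rw [conjTranspose_smul, (isHermitian_spinOp n k).eq, Complex.star_def, Complex.conj_ofReal]

theorem conjTranspose_rotation_smul (n : ℕ) (g : Fin 3 → ℝ) (t : ℝ) :
    (rotation n (t • g))ᴴ = NormedSpace.exp (t • -rotationGen n g) := by
  rw [rotation_smul, ← Matrix.exp_conjTranspose, conjTranspose_smul, conjTranspose_rotationGen,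
    star_trivial]

section Derivative

attribute [local instance] Matrix.linftyOpNormedRing Matrix.linftyOpNormedAlgebra

/-- The derivative is a conjugate of the defect `E([A, Y]) - [B, E(Y)]`, where `Y` is the rotated
`X`. Evaluation at `t = 0` gives infinitesimal covariance; conversely, a vanishing defect makes the
curve constant. -/
theorem hasDerivAt_conj_exp {a b : ℕ} (E : SuperOp a b) (A X : Op a) (B : Op b) (t : ℝ) :
    HasDerivAt (fun t : ℝ => NormedSpace.exp (t • -B) *
        E (NormedSpace.exp (t • A) * X * NormedSpace.exp (t • -A)) * NormedSpace.exp (t • B))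
      (NormedSpace.exp (t • -B) *
        (E (A * (NormedSpace.exp (t • A) * X * NormedSpace.exp (t • -A)) -
            NormedSpace.exp (t • A) * X * NormedSpace.exp (t • -A) * A) -
          (B * E (NormedSpace.exp (t • A) * X * NormedSpace.exp (t • -A)) -
            E (NormedSpace.exp (t • A) * X * NormedSpace.exp (t • -A)) * B)) *
        NormedSpace.exp (t • B)) t := by
  have hA : HasDerivAt (fun t : ℝ => NormedSpace.exp (t • A)) (A * NormedSpace.exp (t • A)) t :=
    hasDerivAt_exp_smul_const' A t
  have hA' : HasDerivAt (fun t : ℝ => NormedSpace.exp (t • -A))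
      (NormedSpace.exp (t • -A) * -A) t := hasDerivAt_exp_smul_const (-A) t
  have hB : HasDerivAt (fun t : ℝ => NormedSpace.exp (t • B)) (B * NormedSpace.exp (t • B)) t :=
    hasDerivAt_exp_smul_const' B t
  have hB' : HasDerivAt (fun t : ℝ => NormedSpace.exp (t • -B))
      (NormedSpace.exp (t • -B) * -B) t := hasDerivAt_exp_smul_const (-B) t
  have hY : HasDerivAt
      (fun t : ℝ => NormedSpace.exp (t • A) * X * NormedSpace.exp (t • -A))
      (A * (NormedSpace.exp (t • A) * X * NormedSpace.exp (t • -A)) -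
        NormedSpace.exp (t • A) * X * NormedSpace.exp (t • -A) * A) t :=
    ((hA.mul_const X).mul hA').congr_deriv (by
      simp only [mul_neg, mul_assoc, sub_eq_add_neg])
  let L : Op a →L[ℝ] Op b := LinearMap.toContinuousLinearMap (E.restrictScalars ℝ)
  have hE : HasDerivAt
      (fun t : ℝ => E (NormedSpace.exp (t • A) * X * NormedSpace.exp (t • -A)))
      (E (A * (NormedSpace.exp (t • A) * X * NormedSpace.exp (t • -A)) -
        NormedSpace.exp (t • A) * X * NormedSpace.exp (t • -A) * A)) t :=
    L.hasFDerivAt.comp_hasDerivAt t hY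
  refine ((hB'.mul hE).mul hB).congr_deriv ?_
  simp only [Pi.mul_apply]
  generalize E (A * (NormedSpace.exp (t • A) * X * NormedSpace.exp (t • -A)) -
        NormedSpace.exp (t • A) * X * NormedSpace.exp (t • -A) * A) = Z
  generalize E (NormedSpace.exp (t • A) * X * NormedSpace.exp (t • -A)) = W
  generalize NormedSpace.exp (t • -B) = U
  generalize NormedSpace.exp (t • B) = V
  noncomm_ring

theorem isInfCovariant_of_isCovariant {a b : ℕ} {E : SuperOp a b} (hE : IsCovariant E) :
    IsInfCovariant E := by
  intro k X
  have h := hasDerivAt_conj_exp E (rotationGen a (Pi.single k 1)) X (rotationGen b (Pi.single k 1)) 0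
  have hc : (fun t : ℝ => NormedSpace.exp (t • -rotationGen b (Pi.single k 1)) *
      E (NormedSpace.exp (t • rotationGen a (Pi.single k 1)) * X *
        NormedSpace.exp (t • -rotationGen a (Pi.single k 1))) *
      NormedSpace.exp (t • rotationGen b (Pi.single k 1))) = fun _ => E X := by
    ext1 t
    rw [← conjTranspose_rotation_smul, ← conjTranspose_rotation_smul, ← rotation_smul,
      ← rotation_smul]
    exact hE _ X
  rw [hc] at h
  have h0 := h.unique (hasDerivAt_const (0 : ℝ) (E X))
  have hg : ∀ n, rotationGen n (Pi.single k 1) = I • spinOp n k := by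
    intro n
    rw [rotationGen, Finset.sum_eq_single k]
    · simp
    · intro j _ hj
      simp [hj]
    · simp
  simp only [zero_smul, NormedSpace.exp_zero, one_mul, mul_one, hg, smul_mul_assoc, mul_smul_comm,
    ← smul_sub, map_smul] at h0
  have h1 := (smul_eq_zero.1 h0).resolve_left Complex.I_ne_zero
  exact (sub_eq_zero.1 h1).symm

theorem isCovariant_of_isInfCovariant {a b : ℕ} {E : SuperOp a b} (hE : IsInfCovariant E) :
    IsCovariant E := by
  intro g X
  have hgen : ∀ Y, E (rotationGen a g * Y - Y * rotationGen a g) =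
      rotationGen b g * E Y - E Y * rotationGen b g := by
    intro Y
    simp only [rotationGen, smul_mul_assoc, mul_smul_comm, Finset.sum_mul, Finset.mul_sum,
      ← smul_sub, ← Finset.sum_sub_distrib, map_smul, map_sum, hE _ Y]
  have hd := fun t => hasDerivAt_conj_exp E (rotationGen a g) X (rotationGen b g) t
  simp only [hgen, sub_self, mul_zero, zero_mul] at hd
  have hconst := is_const_of_deriv_eq_zero (fun t => (hd t).differentiableAt)
    (fun t => (hd t).deriv) 1 0
  simp only [zero_smul, NormedSpace.exp_zero, one_mul, mul_one] at hconst
  rw [← conjTranspose_rotation_smul, ← conjTranspose_rotation_smul, ← rotation_smul,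
    ← rotation_smul, one_smul] at hconst
  exact hconst

end Derivative

/-- The entries of `[T^k, C]` are those of the covariance defect on matrix units; the transpose in
`T^k` accounts for the action on the input. -/
theorem choi_spinOp_mul {a b : ℕ} (E : SuperOp a b) (k : Fin 3) (x y : Fin (b + 1) × Fin (a + 1)) :
    (totalSpinOp a b k * choi E - choi E * totalSpinOp a b k) x y =
      (spinOp b k * E (Matrix.single x.2 y.2 1) - E (Matrix.single x.2 y.2 1) * spinOp b k -
        E (spinOp a k * Matrix.single x.2 y.2 1 - Matrix.single x.2 y.2 1 * spinOp a k)) x.1 y.1 := by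
  have h1 : (Matrix.kronecker (spinOp b k) (1 : Op a) * choi E) x y =
      (spinOp b k * E (Matrix.single x.2 y.2 1)) x.1 y.1 := by
    simp [Matrix.mul_apply, Fintype.sum_prod_type, one_apply, choi]
  have h2 : (choi E * Matrix.kronecker (spinOp b k) (1 : Op a)) x y =
      (E (Matrix.single x.2 y.2 1) * spinOp b k) x.1 y.1 := by
    simp [Matrix.mul_apply, Fintype.sum_prod_type, one_apply, choi]
  have h3 : (Matrix.kronecker (1 : Op b) (spinOp a k)ᵀ * choi E) x y =
      E (spinOp a k * Matrix.single x.2 y.2 1) x.1 y.1 := by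
    rw [apply_eq_sum_choi, Matrix.mul_apply, Fintype.sum_prod_type]
    simp [Matrix.mul_apply, one_apply, Matrix.single, mul_comm, ite_and]
  have h4 : (choi E * Matrix.kronecker (1 : Op b) (spinOp a k)ᵀ) x y =
      E (Matrix.single x.2 y.2 1 * spinOp a k) x.1 y.1 := by
    rw [apply_eq_sum_choi, Matrix.mul_apply, Fintype.sum_prod_type]
    simp [Matrix.mul_apply, one_apply, Matrix.single, mul_comm, ite_and]
  rw [totalSpinOp_eq, sub_mul, mul_sub, map_sub]
  simp only [Matrix.sub_apply, h1, h2, h3, h4]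
  ring

theorem isInfCovariant_iff_commute {a b : ℕ} (E : SuperOp a b) :
    IsInfCovariant E ↔ ∀ k, Commute (totalSpinOp a b k) (choi E) := by
  constructor
  · intro h k
    rw [commute_iff_eq, ← sub_eq_zero]
    ext x y
    rw [choi_spinOp_mul, h, sub_self, Matrix.zero_apply, Matrix.zero_apply]
  · intro h k X
    have hs : ∀ i j, spinOp b k * E (Matrix.single i j 1) - E (Matrix.single i j 1) * spinOp b k -
        E (spinOp a k * Matrix.single i j 1 - Matrix.single i j 1 * spinOp a k) = 0 := by
      intro i j
      ext p q
      rw [← choi_spinOp_mul E k (p, i) (q, j), sub_eq_zero.2 (h k).eq, Matrix.zero_apply,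
        Matrix.zero_apply]
    let F : SuperOp a b := (LinearMap.mulLeft ℂ (spinOp b k)).comp E -
      (LinearMap.mulRight ℂ (spinOp b k)).comp E -
      E.comp (LinearMap.mulLeft ℂ (spinOp a k) - LinearMap.mulRight ℂ (spinOp a k))
    have hF : F = 0 := by
      apply choi_injective
      ext x y
      exact congrFun (congrFun (hs x.2 y.2) x.1) y.1
    exact sub_eq_zero.1 (LinearMap.congr_fun hF X)

/-! ### Scalar and vector operators -/

theorem raising_apply_ne_zero {n : ℕ} {i k : Fin (n + 1)} (h : (i : ℕ) + 1 = k) :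
    raising n i k ≠ 0 := by
  have hk : (k : ℝ) < n + 1 := by exact_mod_cast k.2
  have hk0 : (0 : ℝ) < k := by exact_mod_cast (by omega : 0 < (k : ℕ))
  rw [raising, of_apply, if_pos h]
  exact Complex.ofReal_ne_zero.2 (Real.sqrt_pos.2 (mul_pos hk0 (by linarith))).ne'

theorem raising_apply_of_ne {n : ℕ} {i k : Fin (n + 1)} (h : (i : ℕ) + 1 ≠ k) :
    raising n i k = 0 := by
  rw [raising, of_apply, if_neg h]

theorem raising_mul_apply {n : ℕ} (W : Op n) {i j : Fin (n + 1)} (h : (i : ℕ) + 1 = j)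
    (k : Fin (n + 1)) : (raising n * W) i k = raising n i j * W j k := by
  rw [Matrix.mul_apply, Finset.sum_eq_single j]
  · intro l _ hl
    rw [raising_apply_of_ne (fun h' => hl (Fin.ext (by omega))), zero_mul]
  · simp

theorem mul_raising_apply {n : ℕ} (W : Op n) {j k : Fin (n + 1)} (h : (j : ℕ) + 1 = k)
    (i : Fin (n + 1)) : (W * raising n) i k = W i j * raising n j k := by
  rw [Matrix.mul_apply, Finset.sum_eq_single j]
  · intro l _ hl
    rw [raising_apply_of_ne (fun h' => hl (Fin.ext (by omega))), mul_zero]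
  · simp

/-- An operator with the commutation relations of the raising operator is a multiple of it. -/
theorem exists_eq_smul_raising {n : ℕ} {W : Op n} (hz : spinOp n 2 * W - W * spinOp n 2 = W)
    (hr : Commute (raising n) W) : ∃ c : ℂ, W = c • raising n := by
  -- The relation with `J^z` says that `W` raises the weight by one, so it is supported on the
  -- superdiagonal.
  have hsupp : ∀ i k : Fin (n + 1), (i : ℕ) + 1 ≠ k → W i k = 0 := by
    intro i k hik
    have h := congrFun (congrFun hz i) k
    rw [spinOp_two, Matrix.sub_apply, diagonal_mul, mul_diagonal] at h
    have h' : ((k : ℂ) - (i + 1)) * W i k = 0 := by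
      push_cast at h
      linear_combination h
    refine (mul_eq_zero.1 h').resolve_left (sub_ne_zero.2 ?_)
    exact_mod_cast Ne.symm hik
  rcases Nat.eq_zero_or_pos n with rfl | hn
  · refine ⟨0, ?_⟩
    ext i k
    rw [hsupp i k (by omega), zero_smul, Matrix.zero_apply]
  have h1 : 1 < n + 1 := by omega
  refine ⟨W ⟨0, by omega⟩ ⟨1, h1⟩ / raising n ⟨0, by omega⟩ ⟨1, h1⟩, ?_⟩
  set c := W ⟨0, by omega⟩ ⟨1, h1⟩ / raising n ⟨0, by omega⟩ ⟨1, h1⟩ with hc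
  -- Commuting with `J₊` makes the ratio of consecutive superdiagonal entries of `W` equal to that
  -- of `J₊`, so the first entry fixes them all.
  have key : ∀ m (hm : m + 1 < n + 1),
      W ⟨m, by omega⟩ ⟨m + 1, hm⟩ = c * raising n ⟨m, by omega⟩ ⟨m + 1, hm⟩ := by
    intro m
    induction m with
    | zero =>
      intro hm
      rw [hc, div_mul_cancel₀]
      exact raising_apply_ne_zero rfl
    | succ m ih =>
      intro hm
      have h := congrFun (congrFun hr.eq ⟨m, by omega⟩) ⟨m + 1 + 1, hm⟩
      rw [raising_mul_apply W (j := ⟨m + 1, by omega⟩) rfl,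
        mul_raising_apply W (j := ⟨m + 1, by omega⟩) rfl, ih (by omega)] at h
      have hne : raising n ⟨m, by omega⟩ ⟨m + 1, by omega⟩ ≠ 0 := raising_apply_ne_zero rfl
      refine mul_left_cancel₀ hne ?_
      rw [h]; ring
  ext i k
  rw [Matrix.smul_apply, smul_eq_mul]
  by_cases hik : (i : ℕ) + 1 = k
  · have := key i (by omega)
    have hk : k = ⟨i + 1, by omega⟩ := Fin.ext hik.symm
    rw [hk]
    exact this
  · rw [hsupp i k hik, raising_apply_of_ne hik, mul_zero]

/-- An operator that commutes with the spin operators is a scalar. -/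
theorem eq_smul_one_of_commute {n : ℕ} {W : Op n} (hz : Commute (spinOp n 2) W)
    (hr : Commute (raising n) W) : W = W 0 0 • 1 := by
  -- Commuting with `J₊` makes neighbouring diagonal entries equal; commuting with `J^z` removes the
  -- others.
  have key : ∀ m (hm : m < n + 1), W ⟨m, hm⟩ ⟨m, hm⟩ = W 0 0 := by
    intro m
    induction m with
    | zero => intro _; rfl
    | succ m ih =>
      intro hm
      have h := congrFun (congrFun hr.eq ⟨m, by omega⟩) ⟨m + 1, hm⟩
      rw [raising_mul_apply W (j := ⟨m + 1, by omega⟩) rfl,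
        mul_raising_apply W (j := ⟨m, by omega⟩) rfl, ih (by omega), mul_comm] at h
      exact mul_right_cancel₀ (raising_apply_ne_zero rfl) h
  ext i k
  rw [Matrix.smul_apply, one_apply, smul_eq_mul]
  by_cases hik : i = k
  · subst hik
    rw [if_pos rfl, mul_one, ← key i i.2]
  · have h := congrFun (congrFun hz.eq i) k
    rw [spinOp_two, diagonal_mul, mul_diagonal] at h
    have h' : ((k : ℂ) - i) * W i k = 0 := by
      push_cast at h
      linear_combination h
    rw [if_neg hik, mul_zero]
    refine (mul_eq_zero.1 h').resolve_left (sub_ne_zero.2 ?_)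
    exact_mod_cast fun h : (k : ℕ) = i => hik (Fin.ext h.symm)

/-! ### Duals of covariant maps -/

section Dual

variable {a b : ℕ} {E : SuperOp a b}

/-- The commutator with a spin operator is antisymmetric for the trace pairing on both sides, so the
two signs cancel. -/
theorem IsInfCovariant.dual_comm (hE : IsInfCovariant E) (k : Fin 3) (Y : Op b) :
    spinOp a k * dual E Y - dual E Y * spinOp a k =
      dual E (spinOp b k * Y - Y * spinOp b k) := by
  apply eq_of_trace_mul_eq
  intro X
  have h := congrArg (fun Z => (Y * Z).trace) (hE k X)
  simp only [mul_sub, trace_sub, map_sub] at h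
  have e1 : (spinOp a k * dual E Y * X).trace = (Y * E (X * spinOp a k)).trace := by
    rw [mul_assoc, trace_mul_comm, mul_assoc, trace_dual_mul]
  have e2 : (dual E Y * spinOp a k * X).trace = (Y * E (spinOp a k * X)).trace := by
    rw [mul_assoc, trace_dual_mul]
  have e3 : (spinOp b k * Y * E X).trace = (Y * (E X * spinOp b k)).trace := by
    rw [mul_assoc, trace_mul_comm, mul_assoc]
  rw [trace_dual_mul, sub_mul, sub_mul, trace_sub, trace_sub, e1, e2, e3, mul_assoc]
  linear_combination h

theorem IsInfCovariant.dual_comm_raising (hE : IsInfCovariant E) (Y : Op b) :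
    raising a * dual E Y - dual E Y * raising a = dual E (raising b * Y - Y * raising b) := by
  have h0 := hE.dual_comm 0 Y
  have h1 := hE.dual_comm 1 Y
  rw [← up_spinOp, ← up_spinOp, up, up]
  simp only [add_mul, mul_add, smul_mul_assoc, mul_smul_comm]
  rw [add_sub_add_comm, add_sub_add_comm, ← smul_sub, ← smul_sub, h0, h1, map_add, map_smul]

theorem IsInfCovariant.dual_comm_lowering (hE : IsInfCovariant E) (Y : Op b) :
    lowering a * dual E Y - dual E Y * lowering a = dual E (lowering b * Y - Y * lowering b) := by
  have h0 := hE.dual_comm 0 Y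
  have h1 := hE.dual_comm 1 Y
  rw [← down_spinOp, ← down_spinOp, down, down]
  simp only [sub_mul, mul_sub, smul_mul_assoc, mul_smul_comm]
  rw [sub_sub_sub_comm (spinOp a 0 * dual E Y), sub_sub_sub_comm (spinOp b 0 * Y), ← smul_sub,
    ← smul_sub, h0, h1, map_sub (dual E) (spinOp b 0 * Y - Y * spinOp b 0), map_smul]

/-- The dual of a covariant map sends the spin operators to a multiple of the spin operators. -/
theorem IsInfCovariant.exists_dual_spinOp (hE : IsInfCovariant E) :
    ∃ c : ℂ, ∀ k, dual E (spinOp b k) = c • spinOp a k := by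
  obtain ⟨c, hc⟩ : ∃ c : ℂ, dual E (raising b) = c • raising a := by
    apply exists_eq_smul_raising
    · rw [hE.dual_comm, spinOp_two_comm_raising]
    · rw [commute_iff_eq, ← sub_eq_zero, hE.dual_comm_raising, sub_self, map_zero]
  -- From `[J₋, J₊] = -2 J^z`; the next component uses `[J₋, J^z] = J₋`.
  have hz : dual E (spinOp b 2) = c • spinOp a 2 := by
    have h := hE.dual_comm_lowering (raising b)
    have e : ∀ n, lowering n * raising n - raising n * lowering n = (-2 : ℂ) • spinOp n 2 := by
      intro n
      rw [← neg_sub, raising_comm_lowering, neg_smul]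
    rw [hc, mul_smul_comm, smul_mul_assoc, ← smul_sub, e, e, map_smul, smul_comm] at h
    exact (smul_right_injective _ (by norm_num : (-2 : ℂ) ≠ 0) h).symm
  have hl : dual E (lowering b) = c • lowering a := by
    have h := hE.dual_comm_lowering (spinOp b 2)
    have e : ∀ n, lowering n * spinOp n 2 - spinOp n 2 * lowering n = lowering n := by
      intro n
      rw [← neg_sub, spinOp_two_comm_lowering, neg_neg]
    rw [hz, mul_smul_comm, smul_mul_assoc, ← smul_sub, e, e] at h
    exact h.symm
  refine ⟨c, fun k => ?_⟩
  fin_cases k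
  · change dual E ((1 / 2 : ℂ) • (raising b + lowering b)) =
      c • ((1 / 2 : ℂ) • (raising a + lowering a))
    rw [map_smul, map_add, hc, hl, ← smul_add, smul_comm]
  · change dual E ((1 / (2 * I) : ℂ) • (raising b - lowering b)) =
      c • ((1 / (2 * I) : ℂ) • (raising a - lowering a))
    rw [map_smul, map_sub, hc, hl, ← smul_sub, smul_comm]
  · exact hz

theorem IsInfCovariant.dual_one (hE : IsInfCovariant E) : ∃ c : ℂ, dual E 1 = c • 1 := by
  refine ⟨_, eq_smul_one_of_commute ?_ ?_⟩
  · rw [commute_iff_eq, ← sub_eq_zero, hE.dual_comm, mul_one, one_mul, sub_self, map_zero]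
  · rw [commute_iff_eq, ← sub_eq_zero, hE.dual_comm_raising, mul_one, one_mul, sub_self, map_zero]

end Dual

/-! ### Polarisation -/

theorem isState_single_zero (a : ℕ) : IsState (Matrix.single 0 0 1 : Op a) := by
  constructor
  · have : (Matrix.single 0 0 1 : Op a) = vecMulVec (Pi.single 0 1) (star (Pi.single 0 1)) := by
      rw [single_eq_single_vecMulVec_single, ← Pi.single_star, star_one]
    rw [this]
    exact posSemidef_vecMulVec_self_star _
  · simp

theorem polarisation_single_zero (a : ℕ) :
    polarisation (Matrix.single 0 0 1 : Op a) 2 = (spin a : ℂ) := by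
  rw [polarisation, trace_mul_single, spinOp_two]
  simp

theorem spin_pos {a : ℕ} (ha : 0 < a) : 0 < spin a := by
  rw [spin]; positivity

theorem spin_nonneg (a : ℕ) : 0 ≤ spin a := by
  rw [spin]; positivity

section Polarisation

variable {a b : ℕ} {E : SuperOp a b}

/-- The highest weight state has polarisation `j_A ≠ 0` along `z`, so it determines the factor. -/
theorem ScalesPolarisation.unique (ha : 0 < a) {κ κ' : ℝ} (h : ScalesPolarisation E κ)
    (h' : ScalesPolarisation E κ') : κ = κ' := by
  have e := (h _ (isState_single_zero a) 2).symm.trans (h' _ (isState_single_zero a) 2)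
  rw [polarisation_single_zero] at e
  have hne : (spin a : ℂ) ≠ 0 := by exact_mod_cast (spin_pos ha).ne'
  exact_mod_cast mul_right_cancel₀ hne e

theorem exists_scalesPolarisation (ha : 0 < a) (hC : (choi E).IsHermitian)
    (hE : IsInfCovariant E) : ∃ κ : ℝ, ScalesPolarisation E κ := by
  obtain ⟨c, hc⟩ := hE.exists_dual_spinOp
  have hpol : ∀ (ρ : Op a) k, polarisation (E ρ) k = c * polarisation ρ k := by
    intro ρ k
    rw [polarisation, ← trace_dual_mul, hc, smul_mul_assoc, trace_smul]
    rfl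
  have hherm : (E (Matrix.single 0 0 1)).IsHermitian := by
    ext i j
    exact congrFun (congrFun hC.eq (i, 0)) (j, 0)
  -- The factor is real because `c j_A` is the trace of a product of two Hermitian matrices.
  have hreal : star (c * (spin a : ℂ)) = c * (spin a : ℂ) := by
    rw [← polarisation_single_zero, ← hpol, polarisation, ← trace_conjTranspose, conjTranspose_mul,
      hherm.eq, (isHermitian_spinOp b 2).eq, trace_mul_comm]
  have hne : (spin a : ℂ) ≠ 0 := by exact_mod_cast (spin_pos ha).ne'
  have hcr : (starRingEnd ℂ) c = c := by
    rw [Complex.star_def, map_mul, Complex.conj_ofReal] at hreal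
    exact mul_right_cancel₀ hne hreal
  obtain ⟨κ, rfl⟩ := Complex.conj_eq_iff_real.1 hcr
  exact ⟨κ, fun ρ _ k => hpol ρ k⟩

theorem exists_scalesPolarisation_of_mem (ha : 0 < a) (hE : E ∈ covariantChannels a b) :
    ∃ κ : ℝ, ScalesPolarisation E κ :=
  exists_scalesPolarisation ha (posSemidef_choi hE.1.1).isHermitian
    (isInfCovariant_of_isCovariant hE.2)

theorem eq_zero_of_forall_trace_mul_vecMulVec {ι : Type*} [Fintype ι] [DecidableEq ι]
    {G : Matrix ι ι ℂ} (h : ∀ v : ι → ℂ, (G * vecMulVec v (star v)).trace = 0) : G = 0 := by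
  apply Matrix.toEuclideanLin.injective
  rw [map_zero]
  refine (inner_map_self_eq_zero _).1 fun x => ?_
  have h1 := h x.ofLp
  rw [trace_mul_comm, trace_vecMulVec_mul_eq] at h1
  rw [← inner_conj_symm]
  simpa [toLpLin_apply, EuclideanSpace.inner_eq_star_dotProduct, dotProduct_comm] using h1

/-- Scaling is only assumed on states. Normalised rank-one matrices are states, and their
expectations determine an operator over `ℂ`. No covariance is needed. -/
theorem ScalesPolarisation.dual_spinOp {κ : ℝ} (h : ScalesPolarisation E κ) (k : Fin 3) :
    dual E (spinOp b k) = (κ : ℂ) • spinOp a k := by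
  rw [← sub_eq_zero]
  apply eq_zero_of_forall_trace_mul_vecMulVec
  intro v
  have hX : (vecMulVec v (star v)).PosSemidef := posSemidef_vecMulVec_self_star v
  set X := vecMulVec v (star v) with hXdef
  by_cases ht : X.trace = 0
  · rw [hX.trace_eq_zero_iff.1 ht, mul_zero, trace_zero]
  · have hs : IsState (X.trace⁻¹ • X) := by
      refine ⟨hX.smul ?_, ?_⟩
      · exact inv_nonneg.2 hX.trace_nonneg
      · rw [trace_smul, smul_eq_mul, inv_mul_cancel₀ ht]
    have := h _ hs k
    rw [polarisation, polarisation, map_smul, mul_smul_comm, mul_smul_comm, trace_smul, trace_smul,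
      smul_eq_mul, smul_eq_mul, mul_left_comm] at this
    have := mul_left_cancel₀ (inv_ne_zero ht) this
    rw [sub_mul, trace_sub, trace_dual_mul, this, smul_mul_assoc, trace_smul, smul_eq_mul, sub_self]

theorem trace_choi (htp : ∀ X : Op a, (E X).trace = X.trace) : (choi E).trace = (a : ℂ) + 1 := by
  have h := trace_choi_mul_kronecker E 1 1
  rw [transpose_one, kronecker, one_kronecker_one, mul_one, one_mul, htp, trace_one] at h
  rw [h]
  simp

/-- The expectation of the gap in the Choi matrix is an affine function of the scaling factor. -/
theorem trace_choi_mul_casimirGap (htp : ∀ X : Op a, (E X).trace = X.trace) {κ : ℝ}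
    (h : ScalesPolarisation E κ) : (choi E * casimirGap a b).trace =
      ((2 * (a + 1) * spin a * (κ * (spin a + 1) + spin b) : ℝ) : ℂ) := by
  -- The sum over `k` is `κ tr(J_A²)`, with `J_A² = j_A(j_A+1)` on a space of dimension `2j_A+1`.
  have hs : (choi E * spinSpin a b).trace =
      (κ : ℂ) * (((spin a * (spin a + 1) : ℝ) : ℂ) * (a + 1)) := by
    rw [spinSpin, Finset.mul_sum, trace_sum]
    have e : ∀ k, (choi E * Matrix.kronecker (spinOp b k) (spinOp a k)ᵀ).trace =
        (κ : ℂ) * (spinOp a k * spinOp a k).trace := by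
      intro k
      rw [trace_choi_mul_kronecker, ← trace_dual_mul, h.dual_spinOp, smul_mul_assoc, trace_smul,
        smul_eq_mul]
    rw [Finset.sum_congr rfl fun k _ => e k, ← Finset.mul_sum, ← trace_sum]
    have hc := casimir_spinOp a
    rw [casimir] at hc
    rw [hc, trace_smul, trace_one]
    simp
  rw [casimirGap_eq, mul_smul_comm, mul_add, mul_smul_comm, mul_one, trace_smul, trace_add,
    trace_smul, hs, trace_choi htp]
  simp only [smul_eq_mul]
  push_cast
  ring

theorem neg_div_le_of_scalesPolarisation (ha : 0 < a) (hE : IsChannel E) {κ : ℝ}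
    (h : ScalesPolarisation E κ) : -(spin b / (spin a + 1)) ≤ κ := by
  have h0 := trace_mul_nonneg_of_posSemidef (posSemidef_choi hE.1) (posSemidef_casimirGap a b)
  rw [trace_choi_mul_casimirGap hE.2 h, Complex.zero_le_real] at h0
  have hp := spin_pos ha
  have h1 : 0 ≤ κ * (spin a + 1) + spin b :=
    nonneg_of_mul_nonneg_right h0 (by positivity)
  rw [← neg_div, div_le_iff₀ (by linarith)]
  linarith

end Polarisation

/-! ### The covariant channel of highest total angular momentum -/

/-- The map `E^(j_A + j_B)`. -/
def topChannel (a b : ℕ) : SuperOp a b :=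
  -- The Choi matrix is `d_A = a + 1` times the Jamiołkowski state, and `2L + 1 = a + b + 1`.
  ofChoi (((a + 1 : ℂ) / (a + b + 1)) • irrepProjector a b (a + b))

theorem add_add_one_ne_zero (a b : ℕ) : (a + b + 1 : ℂ) ≠ 0 := by
  exact_mod_cast Nat.succ_ne_zero (a + b)

theorem choi_topChannel (a b : ℕ) :
    choi (topChannel a b) = ((a + 1 : ℂ) / (a + b + 1)) • irrepProjector a b (a + b) :=
  choi_ofChoi _

theorem isIrrepChannel_topChannel (a b : ℕ) : IsIrrepChannel (a + b) (topChannel a b) := by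
  have h1 : (a + 1 : ℂ) ≠ 0 := Nat.cast_add_one_ne_zero a
  have h2 := add_add_one_ne_zero a b
  rw [IsIrrepChannel, jamiolkowski_eq, choi_topChannel, smul_smul]
  congr 1
  rw [spin]
  push_cast
  rw [mul_div_cancel₀ _ (two_ne_zero)]
  field_simp

theorem posSemidef_choi_topChannel (a b : ℕ) : (choi (topChannel a b)).PosSemidef := by
  rw [choi_topChannel]
  exact (posSemidef_irrepProjector a b (a + b)).smul (by positivity)

theorem isInfCovariant_topChannel (a b : ℕ) : IsInfCovariant (topChannel a b) := by
  rw [isInfCovariant_iff_commute, choi_topChannel]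
  intro k
  exact (commute_totalSpinOp_eigenProjector a b _ k).smul_right _

/-- By covariance the dual of the identity is a scalar, so the trace is preserved up to a constant,
which the trace of the Choi matrix shows to be one. -/
theorem trace_topChannel (a b : ℕ) (X : Op a) : (topChannel a b X).trace = X.trace := by
  obtain ⟨c, hc⟩ := (isInfCovariant_topChannel a b).dual_one
  have htr : ∀ X : Op a, (topChannel a b X).trace = c * X.trace := by
    intro X
    have := trace_dual_mul (topChannel a b) 1 X
    rw [hc, one_mul, smul_mul_assoc, one_mul, trace_smul, smul_eq_mul] at this
    exact this.symm
  have h := trace_choi_mul_kronecker (topChannel a b) 1 1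
  rw [transpose_one, kronecker, one_kronecker_one, mul_one, one_mul, htr, trace_one,
    choi_topChannel, trace_smul, trace_irrepProjector, smul_eq_mul,
    div_mul_cancel₀ _ (add_add_one_ne_zero a b)] at h
  have h1 : (a + 1 : ℂ) ≠ 0 := Nat.cast_add_one_ne_zero a
  have hc1 : c = 1 := by
    simp only [Fintype.card_fin] at h
    push_cast at h
    exact (mul_right_cancel₀ h1 ((one_mul _).trans h)).symm
  rw [htr, hc1, one_mul]

theorem topChannel_mem (a b : ℕ) : topChannel a b ∈ covariantChannels a b :=
  ⟨⟨isCompletelyPositive_ofChoi (by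
      rw [← choi_topChannel]; exact posSemidef_choi_topChannel a b), trace_topChannel a b⟩,
    isCovariant_of_isInfCovariant (isInfCovariant_topChannel a b)⟩

/-- The gap annihilates the spin-`L` projector, so the affine function of `κ` vanishes; this
determines `κ` without computing any matrix entry. -/
theorem scalesPolarisation_topChannel {a : ℕ} (ha : 0 < a) (b : ℕ) :
    ScalesPolarisation (topChannel a b) (-(spin b / (spin a + 1))) := by
  obtain ⟨κ, hκ⟩ := exists_scalesPolarisation ha (posSemidef_choi_topChannel a b).isHermitian
    (isInfCovariant_topChannel a b)
  have h := trace_choi_mul_casimirGap (trace_topChannel a b) hκ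
  have h0 : casimirGap a b * irrepProjector a b (a + b) = 0 := by
    rw [casimirGap, sub_mul, smul_mul_assoc, one_mul, irrepProjector_eq, mul_eigenProjector,
      sub_self]
  rw [trace_mul_comm, choi_topChannel, mul_smul_comm, h0, smul_zero, trace_zero] at h
  have h' : 2 * (a + 1) * spin a * (κ * (spin a + 1) + spin b) = 0 := by exact_mod_cast h.symm
  have hp := spin_pos ha
  have hk : κ * (spin a + 1) + spin b = 0 := (mul_eq_zero.1 h').resolve_left (by positivity)
  have : κ = -(spin b / (spin a + 1)) := by
    rw [← neg_div, eq_div_iff (by positivity)]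
    linarith
  rwa [this] at hκ

/-- The least scaling factor is attained by one covariant channel only. -/
theorem eq_topChannel {a b : ℕ} {E : SuperOp a b} (hE : E ∈ covariantChannels a b)
    (h : ScalesPolarisation E (-(spin b / (spin a + 1)))) : E = topChannel a b := by
  have hp := spin_nonneg a
  have hC := posSemidef_choi hE.1.1
  have htr := trace_choi_mul_casimirGap hE.1.2 h
  have hk : -(spin b / (spin a + 1)) * (spin a + 1) + spin b = 0 := by
    rw [neg_mul, div_mul_cancel₀ _ (by positivity), neg_add_cancel]
  rw [hk, mul_zero, Complex.ofReal_zero] at htr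
  -- Equality in the trace bound confines the Choi matrix to the kernel of the gap, where Schur's
  -- lemma applies.
  have h0 := mul_eq_zero_of_trace_mul_eq_zero hC (posSemidef_casimirGap a b) htr
  have hcomm := (isInfCovariant_iff_commute E).1 (isInfCovariant_of_isCovariant hE.2)
  have hP := eq_smul_irrepProjector hC.isHermitian hcomm h0
  have ht := trace_choi hE.1.2
  rw [hP, trace_smul, trace_irrepProjector, smul_eq_mul] at ht
  apply choi_injective
  rw [choi_topChannel, hP]
  congr 1
  rw [eq_div_iff (add_add_one_ne_zero a b), ht]

theorem topChannel_mem_extremePoints {a : ℕ} (ha : 0 < a) (b : ℕ) :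
    topChannel a b ∈ Set.extremePoints ℝ (covariantChannels a b) := by
  refine ⟨topChannel_mem a b, ?_⟩
  rintro E hE F hF ⟨s, t, hs, ht, hst, hEF⟩
  obtain ⟨κ, hκ⟩ := exists_scalesPolarisation_of_mem ha hE
  obtain ⟨ν, hν⟩ := exists_scalesPolarisation_of_mem ha hF
  -- The factor is affine along the segment, and its minimum is attained at an interior point, so
  -- both ends attain it.
  have hmix : ScalesPolarisation (topChannel a b) (s * κ + t * ν) := by
    intro ρ hρ k
    have e : polarisation (topChannel a b ρ) k =
        s * polarisation (E ρ) k + t * polarisation (F ρ) k := by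
      rw [← hEF]
      simp only [polarisation, LinearMap.add_apply, LinearMap.smul_apply, mul_add, mul_smul_comm,
        trace_add, trace_smul, Complex.real_smul]
    rw [e, hκ ρ hρ, hν ρ hρ]
    push_cast
    ring
  have heq := hmix.unique ha (scalesPolarisation_topChannel ha b)
  have h1 := neg_div_le_of_scalesPolarisation ha hE.1 hκ
  have h2 := neg_div_le_of_scalesPolarisation ha hF.1 hν
  have hκ' : κ = -(spin b / (spin a + 1)) := by
    refine le_antisymm (le_of_not_gt fun hlt => ?_) h1
    have e1 := mul_pos hs (sub_pos.2 hlt)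
    have e2 := mul_nonneg ht.le (sub_nonneg.2 h2)
    have e3 : (s + t) * -(spin b / (spin a + 1)) = -(spin b / (spin a + 1)) := by
      rw [hst, one_mul]
    linarith
  exact eq_topChannel hE (hκ' ▸ hκ)

end SpinChannel

end

/-! ### The main theorem -/

theorem mainTheorem1 (a b : ℕ) (ha : 0 < a) (jA jB κm : ℝ)
    (hjA : jA = SpinChannel.spin a) (hjB : jB = SpinChannel.spin b)
    (hκm : κm = -(jB / (jA + 1))) :
    -- every covariant channel scales the polarisation vector by a well-defined factor
    (∀ E ∈ SpinChannel.covariantChannels a b, ∃! κ : ℝ, SpinChannel.ScalesPolarisation E κ) ∧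
    -- `E^(j_A + j_B)` is an extremal covariant channel with factor `κ_-`
    (∃ E : SpinChannel.SuperOp a b,
      SpinChannel.IsIrrepChannel (a + b) E ∧
      E ∈ Set.extremePoints ℝ (SpinChannel.covariantChannels a b) ∧
      SpinChannel.ScalesPolarisation E κm) ∧
    -- `κ_-` is the least factor among covariant channels
    IsLeast {κ : ℝ | ∃ E ∈ SpinChannel.covariantChannels a b,
      SpinChannel.ScalesPolarisation E κ} κm ∧
    -- and also among all channels that scale the polarisation vector
    IsLeast {κ : ℝ | ∃ E : SpinChannel.SuperOp a b, SpinChannel.IsChannel E ∧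
      SpinChannel.ScalesPolarisation E κ} κm ∧
    -- it is an inversion when the output spin is not zero
    (0 < b → κm < 0) ∧
    -- equal spins
    (∀ j : ℝ, jA = j → jB = j → κm = -(j / (j + 1))) := by
  subst hjA hjB hκm
  have hmem := SpinChannel.topChannel_mem a b
  have hsc := SpinChannel.scalesPolarisation_topChannel ha b
  refine ⟨fun E hE => ?_, ⟨_, SpinChannel.isIrrepChannel_topChannel a b,
    SpinChannel.topChannel_mem_extremePoints ha b, hsc⟩, ⟨⟨_, hmem, hsc⟩, ?_⟩,
    ⟨⟨_, hmem.1, hsc⟩, ?_⟩, fun hb => ?_, ?_⟩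
  · obtain ⟨κ, hκ⟩ := SpinChannel.exists_scalesPolarisation_of_mem ha hE
    exact ⟨κ, hκ, fun κ' hκ' => hκ'.unique ha hκ⟩
  · rintro κ ⟨E, hE, hκ⟩
    exact SpinChannel.neg_div_le_of_scalesPolarisation ha hE.1 hκ
  · rintro κ ⟨E, hE, hκ⟩
    exact SpinChannel.neg_div_le_of_scalesPolarisation ha hE hκ
  · have h1 := SpinChannel.spin_pos ha
    have h2 := SpinChannel.spin_pos hb
    exact neg_neg_of_pos (by positivity)
  · rintro j rfl h
    rw [h]
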